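/- Let $0<\beta<1$ and $\lambda\ge 0$, and put $\psi_\lambda(s)=(s+\lambda)^\beta-\lambda^\beta$ and $$\phi_\lambda(t,\infty)=\frac{1}{\Gamma(1-\beta)}\int_t^\infty e^{-\lambda r}\,\beta r^{-\beta-1}\,dr\qquad(t>0).$$ Let $(D_\lambda(x))_{x\ge0}$ be a tempered stable subordinator, that is, a process with $D_\lambda(0)=0$, stationary independent increments and nondecreasing right-continuous paths, such that $\mathbb E[e^{-sD_\lambda(x)}]=e^{-x\psi_\lambda(s)}$ for all $s,x\ge 0$. Let $q_\lambda(\cdot,x)$ be the Lebesgue density of $D_\lambda(x)$, let $E_\lambda(t)=\inf\{x>0: D_\lambda(x)>t\}$ be the inverse tempered stable subordinator, and let $$g_\lambda(t,x)=\int_0^t\phi_\lambda(t-y,\infty)\,q_\lambda(y,x)\,dy\qquad(t,x>0).$$ For a function $u$ on $[0,\infty)$ define the Riemann–Liouville and Caputo tempered fractional derivatives at $t>0$ by $$\frac{\partial^{\beta,\lambda}}{\partial t^{\beta,\lambda}}u(t)=\frac{e^{-\lambda t}}{\Gamma(1-\beta)}\frac{d}{dt}\int_0^t\frac{e^{\lambda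 r}u(r)}{(t-r)^\beta}\,dr-\lambda^\beta u(t),\qquad \Big(\frac{\partial}{\partial t}\Big)^{\beta,\lambda}u(t)=\frac{\partial^{\beta,\lambda}}{\partial t^{\beta,\lambda}}u(t)-u(0)\,\phi_\lambda(t,\infty).$$ Let $\mu>0$ and $\check g_\lambda(t,\mu)=\mathbb E[e^{-\mu E_\lambda(t)}]$ for $t\ge 0$. Then, for every $t>0$, $$\check g_\lambda(t,\mu)=\int_0^\infty e^{-\mu x}g_\lambda(t,x)\,dx,$$ where this integral and, for every $x>0$, the integral defining $g_\lambda(t,x)$ converge absolutely, and $\check g_\lambda(\cdot,\mu)$ is a mild solution of the eigenvalue problem $$\Big(\frac{\partial}{\partial t}\Big)^{\beta,\lambda}\check g_\lambda(t,\mu)=-\mu\,\check g_\lambda(t,\mu),\qquad \check g_\lambda(0,\mu)=1,$$ where also $\check g_\lambda(t,\mu)\to1$ as $t\downarrow0$. Here "mild solution" means that the equation holds in Laplace-transform space: with $\mathcal L[f](s)=\int_0^\infty e^{-st}f(t)\,dt$, the Caputo tempered fractional derivative of $u=\check g_\lambda(\cdot,\mu)$ exists at every $t>0$, the Laplace integrals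 of $u$ and of $(\partial/\partial t)^{\beta,\lambda}u$ converge absolutely for every $s>0$, and for every $s>0$ $$\mathcal L\Big[\Big(\frac{\partial}{\partial t}\Big)^{\beta,\lambda}u\Big](s)=\mathcal L[-\mu u](s)\qquad\text{and}\qquad \psi_\lambda(s)\,\mathcal L[u](s)-s^{-1}\psi_\lambda(s)\,u(0)=-\mu\,\mathcal L[u](s).$$ -/

import Mathlib

open MeasureTheory ProbabilityTheory Set Filter Topology
open scoped NNReal

noncomputable section

namespace TemperedStable

/-- The Laplace symbol `ψ_λ(s) = (s + λ)^β - λ^β`. -/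
def symbol (β lam s : ℝ) : ℝ := (s + lam) ^ β - lam ^ β

/-- `D` is a tempered stable subordinator with stability index `β` and tempering parameter `lam`:
a process started at zero with stationary independent increments and (almost surely)
nondecreasing right-continuous paths, such that `E[exp(-s D(x))] = exp(-x ψ_λ(s))`.
Left limits exist automatically, by monotonicity. -/
structure IsSubordinator {Ω : Type*} [MeasurableSpace Ω] (β lam : ℝ)
    (D : ℝ≥0 → Ω → ℝ) (P : Measure Ω) : Prop where
  measurable : ∀ x, Measurable (D x)
  zero : ∀ᵐ ω ∂P, D 0 ω = 0
  mono : ∀ᵐ ω ∂P, Monotone fun x => D x ω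
  right_cont : ∀ᵐ ω ∂P, ∀ x, ContinuousWithinAt (fun y => D y ω) (Ici x) x
  indep_increments : HasIndepIncrements D P
  stationary_increments : ∀ x h, IdentDistrib (fun ω => D (x + h) ω - D x ω) (D h) P P
  laplace : ∀ (x : ℝ≥0) (s : ℝ), 0 ≤ s →
    ∫ ω, Real.exp (-s * D x ω) ∂P = Real.exp (-(x : ℝ) * symbol β lam s)

/-- The inverse process `E(t) = inf {x > 0 : D(x) > t}`. For a tempered stable subordinator the set
is almost surely nonempty. -/
def inverse {Ω : Type*} (D : ℝ≥0 → Ω → ℝ) (t : ℝ) (ω : Ω) : ℝ :=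
  ((sInf {x : ℝ≥0 | 0 < x ∧ t < D x ω} : ℝ≥0) : ℝ)

/-- The tail `φ_λ(t, ∞)` of the Lévy measure `φ_λ(dr) = e^{-λ r} β r^{-β-1} dr / Γ(1-β)`. -/
def levyTail (β lam t : ℝ) : ℝ :=
  1 / Real.Gamma (1 - β) * ∫ r in Ioi t, Real.exp (-lam * r) * (β * r ^ (-β - 1))

/-- The Lebesgue density `q(t, x)`, in the variable `t`, of the random variable `D(x)`. -/
def density {Ω : Type*} [MeasurableSpace Ω] (D : ℝ≥0 → Ω → ℝ) (P : Measure Ω) (t x : ℝ) : ℝ :=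
  (pdf (D x.toNNReal) P volume t).toReal

/-- The inverse tempered stable density `g_λ(t, x) = ∫_0^t φ_λ(t - y, ∞) q(y, x) dy`. -/
def inverseDensity {Ω : Type*} [MeasurableSpace Ω] (β lam : ℝ) (D : ℝ≥0 → Ω → ℝ) (P : Measure Ω)
    (t x : ℝ) : ℝ :=
  ∫ y in (0 : ℝ)..t, levyTail β lam (t - y) * density D P y x

/-- `E[exp(-μ E(t))]`, the Laplace transform of the law of the inverse process at time `t`. -/
def gCheck {Ω : Type*} [MeasurableSpace Ω] (D : ℝ≥0 → Ω → ℝ) (P : Measure Ω) (μ t : ℝ) : ℝ :=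
  ∫ ω, Real.exp (-μ * inverse D t ω) ∂P

/-- `∫_0^t e^{λ r} u(r) (t - r)^{-β} dr`. -/
def fracIntegral (β lam : ℝ) (u : ℝ → ℝ) (t : ℝ) : ℝ :=
  ∫ r in (0 : ℝ)..t, Real.exp (lam * r) * u r / (t - r) ^ β

/-- The Riemann-Liouville tempered fractional derivative. -/
def rlDeriv (β lam : ℝ) (u : ℝ → ℝ) (t : ℝ) : ℝ :=
  Real.exp (-lam * t) * (1 / Real.Gamma (1 - β)) * deriv (fracIntegral β lam u) t - lam ^ β * u t

/-- The Caputo tempered fractional derivative. -/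
def caputoDeriv (β lam : ℝ) (u : ℝ → ℝ) (t : ℝ) : ℝ :=
  rlDeriv β lam u t -
    u 0 / Real.Gamma (1 - β) * ∫ r in Ioi t, Real.exp (-lam * r) * (β * r ^ (-β - 1))

/-- The function `f` on `(0, ∞)` has an absolutely convergent Laplace integral at `s`. -/
def LaplaceConverges (f : ℝ → ℝ) (s : ℝ) : Prop :=
  IntegrableOn (fun t => Real.exp (-s * t) * f t) (Ioi 0)

/-- The Laplace transform `∫_0^∞ e^{-st} f(t) dt`. -/
def laplace (f : ℝ → ℝ) (s : ℝ) : ℝ := ∫ t in Ioi (0 : ℝ), Real.exp (-s * t) * f t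

/-- `u` is a mild solution of `(∂_t)^{β,λ} u = -μ u`: its Laplace transform solves the corresponding
equation in transform space. Both renderings of that equation are required: the Laplace transforms
of the two sides exist and agree (where the derivative in the definition of the operator really
exists at all positive times), and the transform `ũ` of `u` satisfies the equation in which the
operator is replaced by its symbol, `ψ_λ(s) ũ(s) - s⁻¹ ψ_λ(s) u(0) = -μ ũ(s)`. -/
structure IsMildSolution (β lam μ : ℝ) (u : ℝ → ℝ) : Prop where
  differentiable : ∀ t, 0 < t → DifferentiableAt ℝ (fracIntegral β lam u) t
  converges : ∀ s, 0 < s → LaplaceConverges u s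
  converges_caputo : ∀ s, 0 < s → LaplaceConverges (caputoDeriv β lam u) s
  transform_eq : ∀ s, 0 < s →
    laplace (caputoDeriv β lam u) s = laplace (fun t => -μ * u t) s
  symbol_eq : ∀ s, 0 < s →
    symbol β lam s * laplace u s - s⁻¹ * symbol β lam s * u 0 = -μ * laplace u s

end TemperedStable

end

open scoped ENNReal

namespace TemperedStable

/-! Write ψ for the symbol, φ for the Lévy tail, u for `gCheck`, and let U(dy) = ∫₀^∞ e^{-μx} P(D(x)
∈ dy) dx be the μ-potential measure. Integrating e^{-xψ(s)} against e^{-μx} shows that U has Laplace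
transform 1/(μ + ψ(s)), in particular total mass 1/μ. Almost surely {E(t) < x} ⊆ {D(x) > t} ⊆ {E(t)
≤ x}, so integration by parts in x gives u(t) = μ U((t, ∞)) = 1 - μ U((-∞, t]) (`ofReal_gCheck`,
`gCheck_eq`). Hence u is continuous with u(0) = 1, because U has no atoms and no mass on (-∞, 0],
and its transform is ψ/(s(μ + ψ)).

By Tonelli, the integral of e^{-μx} g(t, x) over x is (φ * U)(t). As φ has transform ψ/s, φ * U and
u have the same transform, so they agree for almost every t by `ext_of_measureLaplace`. Equality at
every t needs continuity of φ * U, which is not immediate since φ blows up at 0. Let V be the Gamma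
kernel with transform (s + λ)^{-β}. The resolvent identity U = V + (λ^β - μ) U * V
(`potential_resolvent`) gives φ * U = φ * V + (λ^β - μ) (φ * V) * U. Here φ * V is bounded and
continuous on (0, ∞), the two singularities cancelling exactly, and U has no atoms, so the right
side is continuous (`lintegral_levyTail_potential_eq`).

The eigenvalue equation is proved pointwise, which is stronger than the mild form. Divided by s + λ,
the transformed equation has only transforms of continuous functions as its terms; inverting it
writes the fractional integral of u as the ordinary integral of an explicit function
(`halfConv_gammaKernel_gCheck`, `fracIntegral_gCheck`). Differentiation gives `caputoDeriv_gCheck`.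

Absolute convergence of the integral defining g needs a locally bounded density of D(x). The
characteristic function of the tilted law e^{-y} P(D(x) ∈ dy) is found by analytic continuation and
decays like exp(-c|θ|^β), so the tilted law has a bounded density (`integrable_charFun_expTilt`,
`exists_le_smul_volume_of_integrable_charFun`). -/

/-! ### Uniqueness of Laplace transforms of measures -/

/-- The Laplace transform `∫ e^{-sy} m(dy)` of a measure on the line. -/
noncomputable def measureLaplace (m : Measure ℝ) (s : ℝ) : ℝ≥0∞ :=
  ∫⁻ y, ENNReal.ofReal (Real.exp (-s * y)) ∂m

/-- The measure `e^{-y} m(dy)`. -/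
noncomputable def expTilt (m : Measure ℝ) : Measure ℝ :=
  m.withDensity fun y => ENNReal.ofReal (Real.exp (-y))

lemma lintegral_expTilt (m : Measure ℝ) {f : ℝ → ℝ≥0∞} (hf : Measurable f) :
    ∫⁻ y, f y ∂expTilt m = ∫⁻ y, ENNReal.ofReal (Real.exp (-y)) * f y ∂m := by
  rw [expTilt, lintegral_withDensity_eq_lintegral_mul _ (by fun_prop) hf]
  rfl

lemma measureLaplace_expTilt (m : Measure ℝ) (s : ℝ) :
    measureLaplace (expTilt m) s = measureLaplace m (s + 1) := by
  rw [measureLaplace, lintegral_expTilt _ (by fun_prop), measureLaplace]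
  congr with y
  rw [← ENNReal.ofReal_mul (by positivity), ← Real.exp_add]
  ring_nf

lemma isFiniteMeasure_expTilt {m : Measure ℝ} (h : measureLaplace m 1 ≠ ∞) :
    IsFiniteMeasure (expTilt m) := by
  refine ⟨?_⟩
  have := measureLaplace_expTilt m 0
  simp only [measureLaplace, neg_zero, zero_mul, Real.exp_zero, ENNReal.ofReal_one,
    lintegral_const, one_mul, zero_add] at this
  rw [this]
  exact lt_top_iff_ne_top.2 h

lemma withDensity_exp_expTilt (m : Measure ℝ) :
    ((expTilt m).withDensity fun y => ENNReal.ofReal (Real.exp y)) = m := by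
  have := withDensity_inv_same (μ := m) (f := fun y => ENNReal.ofReal (Real.exp (-y)))
    (by fun_prop) (ae_of_all _ fun y => by simp [Real.exp_pos]) (ae_of_all _ fun y => by simp)
  rw [expTilt]
  convert this using 2
  ext y
  rw [← ENNReal.ofReal_inv_of_pos (Real.exp_pos _), ← Real.exp_neg, neg_neg]

lemma integrable_exp_mul_expTilt {m : Measure ℝ} {t : ℝ} (h : measureLaplace m (1 - t) ≠ ∞) :
    Integrable (fun y => Real.exp (t * y)) (expTilt m) := by
  refine ⟨by fun_prop, ?_⟩
  rw [hasFiniteIntegral_iff_ofReal (ae_of_all _ fun _ => (Real.exp_pos _).le)]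
  have := measureLaplace_expTilt m (-t)
  rw [measureLaplace, neg_neg] at this
  rw [this, neg_add_eq_sub]
  exact lt_top_iff_ne_top.2 h

/-- This is what the tilt is for: it makes the measure finite and shifts the domain of its moment
generating function, so that the imaginary axis, where the characteristic function lives, lies in
the interior. -/
lemma Iio_subset_interior_integrableExpSet {m : Measure ℝ}
    (h : ∀ s, 0 < s → measureLaplace m s ≠ ∞) :
    Iio 1 ⊆ interior (integrableExpSet id (expTilt m)) :=
  interior_maximal (fun _ ht => integrable_exp_mul_expTilt (h _ (sub_pos.2 ht))) isOpen_Iio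

/-- Two analytic functions on a left half-plane that agree on its real points are equal. -/
lemma eqOn_halfPlane {F G : ℂ → ℂ} {a : ℝ} (hF : AnalyticOnNhd ℂ F {z | z.re < a})
    (hG : AnalyticOnNhd ℂ G {z | z.re < a}) (h : ∀ t : ℝ, t < a → F t = G t) :
    EqOn F G {z | z.re < a} := by
  refine AnalyticOnNhd.eqOn_of_preconnected_of_frequently_eq hF hG
    (convex_halfSpace_re_lt a).isPreconnected (z₀ := ((a - 1 : ℝ) : ℂ)) (by simp) ?_
  have hreal : ∃ᶠ x : ℝ in 𝓝[≠] (a - 1), F x = G x := by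
    refine Eventually.frequently ?_
    filter_upwards [mem_nhdsWithin_of_mem_nhds (Iio_mem_nhds (by linarith : a - 1 < a))] with x hx
    exact h x hx
  have ht : Tendsto (fun x : ℝ => (x : ℂ)) (𝓝[≠] (a - 1)) (𝓝[≠] ((a - 1 : ℝ) : ℂ)) := by
    refine tendsto_nhdsWithin_iff.2 ⟨Complex.continuous_ofReal.continuousAt.mono_left
      nhdsWithin_le_nhds, ?_⟩
    filter_upwards [self_mem_nhdsWithin] with x hx
    exact fun h0 => hx (Complex.ofReal_injective h0)
  exact ht.frequently hreal

lemma complexMGF_ofReal_expTilt (m : Measure ℝ) (t : ℝ) :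
    complexMGF id (expTilt m) t = ((measureLaplace m (1 - t)).toReal : ℂ) := by
  rw [complexMGF_ofReal, mgf, integral_eq_lintegral_of_nonneg_ae
    (ae_of_all _ fun _ => (Real.exp_pos _).le) (by fun_prop)]
  have := measureLaplace_expTilt m (-t)
  rw [measureLaplace, neg_neg, neg_add_eq_sub] at this
  simp only [id]
  rw [this]

lemma analyticOnNhd_complexMGF_expTilt {m : Measure ℝ}
    (h : ∀ s, 0 < s → measureLaplace m s ≠ ∞) :
    AnalyticOnNhd ℂ (complexMGF id (expTilt m)) {z | z.re < 1} :=
  analyticOnNhd_complexMGF.mono fun _ hz => Iio_subset_interior_integrableExpSet h hz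

/-- A measure is determined by its Laplace transform on `(0, ∞)`, if that is finite. -/
theorem ext_of_measureLaplace {m m' : Measure ℝ} (h : ∀ s, 0 < s → measureLaplace m s ≠ ∞)
    (h' : ∀ s, 0 < s → measureLaplace m s = measureLaplace m' s) : m = m' := by
  have h2 : ∀ s, 0 < s → measureLaplace m' s ≠ ∞ := fun s hs => h' s hs ▸ h s hs
  have := isFiniteMeasure_expTilt (h 1 one_pos)
  have := isFiniteMeasure_expTilt (h2 1 one_pos)
  have key := eqOn_halfPlane (analyticOnNhd_complexMGF_expTilt h)
    (analyticOnNhd_complexMGF_expTilt h2) fun t ht => by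
      rw [complexMGF_ofReal_expTilt, complexMGF_ofReal_expTilt, h' _ (sub_pos.2 ht)]
  have : expTilt m = expTilt m' := by
    -- The characteristic function is the complex moment generating function on the line of real
    -- part 0, inside the half-plane where the two continuations agree.
    refine Measure.ext_of_charFun (funext fun t => ?_)
    rw [← complexMGF_id_mul_I, ← complexMGF_id_mul_I]
    exact key (by simp)
  rw [← withDensity_exp_expTilt m, this, withDensity_exp_expTilt]

/-! ### Integrable characteristic functions and bounded densities -/

/-- The Gaussian bump at x is the characteristic function of N(0, v) at x - y. Fubini moves the
Fourier transform onto `m`, and the density of N(0, v) is at most its maximum 1/√(2πv). -/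
lemma integral_gaussian_translate_le {m : Measure ℝ} [IsFiniteMeasure m]
    (hm : Integrable (charFun m)) {v : ℝ≥0} (hv : v ≠ 0) (y : ℝ) :
    ∫ x, Real.exp (-(v * (x - y) ^ 2 / 2)) ∂m ≤
      (√(2 * Real.pi * v))⁻¹ * ∫ θ, ‖charFun m θ‖ := by
  have hg : ∀ x : ℝ, ((Real.exp (-(v * (x - y) ^ 2 / 2)) : ℝ) : ℂ) =
      ∫ θ, Complex.exp (θ * (x - y : ℝ) * Complex.I) ∂gaussianReal 0 v := by
    intro x
    have := charFun_gaussianReal (μ := 0) (v := v) (x - y)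
    rw [charFun_apply_real] at this
    rw [Complex.ofReal_exp]
    convert this.symm using 2
    · push_cast; ring
    · ext θ; congr 1; push_cast; ring
  have hint : Integrable (fun p : ℝ × ℝ => Complex.exp (p.2 * (p.1 - y : ℝ) * Complex.I))
      (m.prod (gaussianReal 0 v)) := by
    refine Integrable.of_bound (C := 1) (by fun_prop) (ae_of_all _ fun p => ?_)
    rw [← Complex.ofReal_mul, Complex.norm_exp_ofReal_mul_I]
  have hkey : ((∫ x, Real.exp (-(v * (x - y) ^ 2 / 2)) ∂m : ℝ) : ℂ) =
      ∫ θ, Complex.exp (-(θ * y) * Complex.I) * charFun m θ ∂gaussianReal 0 v := by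
    rw [← integral_complex_ofReal]
    simp_rw [hg]
    rw [integral_integral_swap hint]
    congr with θ
    rw [charFun_apply_real, ← integral_const_mul]
    congr with x
    rw [← Complex.exp_add]
    congr 1
    push_cast
    ring
  have hnn : 0 ≤ ∫ x, Real.exp (-(v * (x - y) ^ 2 / 2)) ∂m := by positivity
  calc ∫ x, Real.exp (-(v * (x - y) ^ 2 / 2)) ∂m
      = ‖((∫ x, Real.exp (-(v * (x - y) ^ 2 / 2)) ∂m : ℝ) : ℂ)‖ := by
        rw [Complex.norm_real, Real.norm_of_nonneg hnn]
    _ ≤ ∫ θ, ‖charFun m θ‖ ∂gaussianReal 0 v := by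
        rw [hkey]
        refine (norm_integral_le_integral_norm _).trans (le_of_eq ?_)
        congr with θ
        rw [norm_mul]
        have : (-((θ : ℂ) * y)) * Complex.I = ((-(θ * y) : ℝ) : ℂ) * Complex.I := by push_cast; ring
        rw [this, Complex.norm_exp_ofReal_mul_I, one_mul]
    _ ≤ ∫ θ, (√(2 * Real.pi * v))⁻¹ * ‖charFun m θ‖ := by
        rw [integral_gaussianReal_eq_integral_smul hv]
        refine integral_mono_of_nonneg (ae_of_all _ fun θ => ?_) (hm.norm.const_mul _)
          (ae_of_all _ fun θ => ?_)
        · exact mul_nonneg (gaussianPDFReal_nonneg _ _ _) (norm_nonneg _)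
        · refine mul_le_mul_of_nonneg_right ?_ (norm_nonneg _)
          rw [gaussianPDFReal]
          refine mul_le_of_le_one_right (by positivity) (Real.exp_le_one_iff.2 ?_)
          exact div_nonpos_of_nonpos_of_nonneg (neg_nonpos.2 (sq_nonneg _)) (by positivity)
    _ = _ := integral_const_mul _ _

/-- A finite measure whose characteristic function is integrable has a bounded density. -/
theorem exists_le_smul_volume_of_integrable_charFun {m : Measure ℝ} [IsFiniteMeasure m]
    (hm : Integrable (charFun m)) : ∃ C : ℝ≥0, m ≤ C • (volume : Measure ℝ) := by
  set I := ∫ θ, ‖charFun m θ‖ with hI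
  have hI0 : 0 ≤ I := by positivity
  set K : ℝ := Real.exp (1 / 2) * I + 1 with hK
  have hK0 : 0 < K := by positivity
  have hball : ∀ (y r : ℝ), 0 < r → m (Metric.closedBall y r) ≤ ENNReal.ofReal (K * r) := by
    intro y r hr
    -- With v = r⁻² the bump has width r: it is at least e^{-1/2} on the ball, while 1/√(2πv) ≤ r.
    -- Hence the mass of a ball is linear in its radius.
    have hle := integral_gaussian_translate_le hm (v := Real.toNNReal (r⁻¹ ^ 2))
      (by simpa using hr.ne') y
    rw [Real.coe_toNNReal _ (by positivity)] at hle
    have h1 : (√(2 * Real.pi * r⁻¹ ^ 2))⁻¹ ≤ r := by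
      rw [Real.sqrt_mul (by positivity), Real.sqrt_sq (by positivity), mul_inv, inv_inv]
      refine mul_le_of_le_one_left hr.le (inv_le_one_of_one_le₀ (Real.one_le_sqrt.2 ?_))
      linarith [Real.pi_gt_three]
    have h2 : m.real (Metric.closedBall y r) * Real.exp (-(1 / 2)) ≤
        ∫ x, Real.exp (-(r⁻¹ ^ 2 * (x - y) ^ 2 / 2)) ∂m := by
      have hint : Integrable (fun x => Real.exp (-(r⁻¹ ^ 2 * (x - y) ^ 2 / 2))) m := by
        refine Integrable.of_bound (C := 1) (by fun_prop) (ae_of_all _ fun x => ?_)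
        rw [Real.norm_of_nonneg (Real.exp_pos _).le, Real.exp_le_one_iff]
        have : 0 ≤ r⁻¹ ^ 2 * (x - y) ^ 2 / 2 := by positivity
        linarith
      rw [← smul_eq_mul, ← setIntegral_const]
      refine (setIntegral_mono_on (integrable_const _).integrableOn hint.integrableOn
        Metric.isClosed_closedBall.measurableSet fun x hx => ?_).trans
        (setIntegral_le_integral hint (ae_of_all _ fun _ => (Real.exp_pos _).le))
      rw [Real.exp_le_exp, neg_le_neg_iff]
      have : |x - y| ≤ r := hx
      have h3 : (x - y) ^ 2 ≤ r ^ 2 := sq_le_sq' (abs_le.1 this).1 (abs_le.1 this).2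
      have h4 : r⁻¹ ^ 2 * (x - y) ^ 2 ≤ r⁻¹ ^ 2 * r ^ 2 := by gcongr
      rw [← mul_pow r⁻¹ r, inv_mul_cancel₀ hr.ne', one_pow] at h4
      linarith
    have h5 : m.real (Metric.closedBall y r) ≤ K * r := by
      have h6 : m.real (Metric.closedBall y r) * Real.exp (-(1 / 2)) ≤ r * I :=
        h2.trans (hle.trans (mul_le_mul_of_nonneg_right h1 hI0))
      rw [Real.exp_neg, ← div_eq_mul_inv, div_le_iff₀ (Real.exp_pos _)] at h6
      nlinarith
    rw [← ofReal_measureReal]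
    exact ENNReal.ofReal_le_ofReal h5
  have hset : ∀ s : Set ℝ, m s ≤ ENNReal.ofReal K * Metric.ediam s := by
    intro s
    rcases s.eq_empty_or_nonempty with rfl | ⟨y, hy⟩
    · simp
    rcases eq_or_ne (Metric.ediam s) ∞ with htop | htop
    · rw [htop, ENNReal.mul_top (by simpa using hK0)]
      exact le_top
    -- The ball estimate needs a positive radius, so the diameter is enlarged by ε/K, which costs
    -- exactly ε.
    refine ENNReal.le_of_forall_pos_le_add fun ε hε _ => ?_
    have hsub : s ⊆ Metric.closedBall y ((Metric.ediam s).toReal + ε / K) := by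
      intro x hx
      have := Metric.edist_le_ediam_of_mem hx hy
      rw [edist_dist, ENNReal.ofReal_le_iff_le_toReal htop] at this
      have : (0 : ℝ) < ε / K := by positivity
      rw [Metric.mem_closedBall]
      linarith
    refine (measure_mono hsub).trans ((hball _ _ (by positivity)).trans ?_)
    rw [mul_add, mul_div_cancel₀ _ hK0.ne', ENNReal.ofReal_add (by positivity) (by positivity),
      ENNReal.ofReal_mul hK0.le, ENNReal.ofReal_toReal htop, ENNReal.ofReal_coe_nnreal]
  refine ⟨Real.toNNReal K, ?_⟩
  -- Lebesgue measure is one-dimensional Hausdorff measure, which dominates every measure bounded by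
  -- the diameter; no differentiation theorem is needed.
  have hle : (ENNReal.ofReal K)⁻¹ • m ≤ (volume : Measure ℝ) := by
    rw [← hausdorffMeasure_real]
    refine Measure.le_hausdorffMeasure 1 _ 1 one_pos fun s _ => ?_
    rw [Measure.smul_apply, smul_eq_mul, ENNReal.rpow_one]
    calc (ENNReal.ofReal K)⁻¹ * m s
        ≤ (ENNReal.ofReal K)⁻¹ * (ENNReal.ofReal K * Metric.ediam s) := by gcongr; exact hset s
      _ = Metric.ediam s := by
        rw [← mul_assoc, ENNReal.inv_mul_cancel (by simpa using hK0) (by simp), one_mul]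
  refine Measure.le_iff.2 fun s _ => ?_
  have := Measure.le_iff'.1 hle s
  rw [Measure.smul_apply, smul_eq_mul, ENNReal.inv_mul_le_iff (by simpa using hK0) (by simp)] at this
  exact this

/-! ### Measures with densities on the half-line and their convolutions -/

/-- The extended nonnegative function that equals `f` on `(0, ∞)` and vanishes elsewhere. -/
noncomputable def halfLine (f : ℝ → ℝ) : ℝ → ℝ≥0∞ :=
  (Ioi 0).indicator fun t => ENNReal.ofReal (f t)

lemma halfLine_of_pos {f : ℝ → ℝ} {t : ℝ} (ht : 0 < t) : halfLine f t = ENNReal.ofReal (f t) :=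
  indicator_of_mem (mem_Ioi.2 ht) _

lemma halfLine_of_nonpos {f : ℝ → ℝ} {t : ℝ} (ht : t ≤ 0) : halfLine f t = 0 :=
  indicator_of_notMem (notMem_Ioi.2 ht) _

lemma halfLine_ne_top (f : ℝ → ℝ) (t : ℝ) : halfLine f t ≠ ∞ := by
  rcases le_or_gt t 0 with h | h
  · simp [halfLine_of_nonpos h]
  · simp [halfLine_of_pos h]

lemma measurable_halfLine {f : ℝ → ℝ} (hf : ContinuousOn f (Ioi 0)) : Measurable (halfLine f) := by
  have h : ContinuousOn (fun t => ENNReal.ofReal (f t)) (Ioi 0) :=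
    ENNReal.continuous_ofReal.comp_continuousOn hf
  have := h.measurable_piecewise (g := 0) continuousOn_const measurableSet_Ioi
  rwa [piecewise_eq_indicator] at this

/-- The measure on `(0, ∞)` with density `f`. -/
noncomputable def dens (f : ℝ → ℝ) : Measure ℝ := volume.withDensity (halfLine f)

lemma measureLaplace_dens {f : ℝ → ℝ} (hf : ContinuousOn f (Ioi 0)) (s : ℝ) :
    measureLaplace (dens f) s = ∫⁻ t in Ioi 0, ENNReal.ofReal (Real.exp (-s * t) * f t) := by
  rw [measureLaplace, dens, lintegral_withDensity_eq_lintegral_mul _ (measurable_halfLine hf)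
    (by fun_prop), ← lintegral_indicator measurableSet_Ioi]
  congr with t
  by_cases ht : t ∈ Ioi (0 : ℝ)
  · rw [indicator_of_mem ht, Pi.mul_apply, halfLine_of_pos ht,
      ENNReal.ofReal_mul (Real.exp_pos _).le, mul_comm]
  · rw [indicator_of_notMem ht, Pi.mul_apply, halfLine_of_nonpos (not_lt.1 ht), zero_mul]

lemma measureLaplace_conv (m n : Measure ℝ) [SFinite n] (s : ℝ) :
    measureLaplace (m ∗ n) s = measureLaplace m s * measureLaplace n s := by
  rw [measureLaplace, Measure.lintegral_conv (by fun_prop), measureLaplace,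
    ← lintegral_mul_const _ (by fun_prop)]
  congr with x
  rw [measureLaplace, ← lintegral_const_mul _ (by fun_prop)]
  congr with y
  rw [← ENNReal.ofReal_mul (Real.exp_pos _).le, ← Real.exp_add]
  ring_nf

lemma measureLaplace_add (m n : Measure ℝ) (s : ℝ) :
    measureLaplace (m + n) s = measureLaplace m s + measureLaplace n s :=
  lintegral_add_measure _ _ _

lemma measureLaplace_smul (c : ℝ≥0) (m : Measure ℝ) (s : ℝ) :
    measureLaplace (c • m) s = c * measureLaplace m s :=
  lintegral_smul_measure _ _

/-- Convolution with a measure that has a density. -/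
lemma withDensity_conv {a : ℝ → ℝ≥0∞} (ha : Measurable a) (n : Measure ℝ) [SFinite n] :
    (volume.withDensity a) ∗ n = volume.withDensity fun t => ∫⁻ y, a (t - y) ∂n := by
  have hm : Measurable fun p : ℝ × ℝ => a (p.1 - p.2) := by fun_prop
  ext s hs
  have hi : Measurable (s.indicator (1 : ℝ → ℝ≥0∞)) := measurable_one.indicator hs
  rw [withDensity_apply _ hs, ← lintegral_indicator_one hs, Measure.lintegral_conv hi,
    lintegral_withDensity_eq_lintegral_mul _ ha (by fun_prop), ← lintegral_indicator hs]
  calc ∫⁻ x, (a * fun x => ∫⁻ y, s.indicator 1 (x + y) ∂n) x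
      = ∫⁻ x, ∫⁻ y, a x * s.indicator 1 (x + y) ∂n := by
        congr with x
        rw [lintegral_const_mul _ (by fun_prop)]; rfl
    _ = ∫⁻ y, (∫⁻ x, a x * s.indicator 1 (x + y)) ∂n :=
        lintegral_lintegral_swap (f := fun x y => a x * s.indicator 1 (x + y))
          (by unfold Function.uncurry; fun_prop)
    _ = ∫⁻ y, (∫⁻ t, a (t - y) * s.indicator 1 t) ∂n := by
        congr with y
        rw [← lintegral_sub_right_eq_self (fun x => a x * s.indicator 1 (x + y)) y]
        simp
    _ = ∫⁻ t, ∫⁻ y, a (t - y) * s.indicator 1 t ∂n :=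
        (lintegral_lintegral_swap (f := fun t y => a (t - y) * s.indicator 1 t)
          (by unfold Function.uncurry; fun_prop)).symm
    _ = _ := by
        congr with t
        by_cases ht : t ∈ s <;> simp [ht]

/-! ### The Gamma kernels, the Lévy tail and their Laplace transforms -/

/-- The Gamma density `e^{-λr} r^{a-1} / Γ(a)`, with Laplace transform `(s + λ)^{-a}`. -/
noncomputable def gammaKernel (a lam r : ℝ) : ℝ := Real.exp (-lam * r) * r ^ (a - 1) / Real.Gamma a

lemma continuousOn_gammaKernel (a lam : ℝ) : ContinuousOn (gammaKernel a lam) (Ioi 0) := by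
  unfold gammaKernel
  refine ContinuousOn.div_const (ContinuousOn.mul (by fun_prop) ?_) _
  exact fun x hx => (Real.continuousAt_rpow_const _ _ (Or.inl (ne_of_gt hx))).continuousWithinAt

lemma gammaKernel_nonneg {a lam r : ℝ} (ha : 0 < a) (hr : 0 < r) : 0 ≤ gammaKernel a lam r := by
  have := Real.Gamma_pos_of_pos ha
  unfold gammaKernel
  positivity

lemma gammaKernel_le {a lam r : ℝ} (ha : 0 < a) (hlam : 0 ≤ lam) (hr : 0 < r) :
    gammaKernel a lam r ≤ r ^ (a - 1) / Real.Gamma a := by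
  have := Real.Gamma_pos_of_pos ha
  unfold gammaKernel
  gcongr
  refine mul_le_of_le_one_left (by positivity) (Real.exp_le_one_iff.2 ?_)
  nlinarith

lemma measureLaplace_gammaKernel {a lam s : ℝ} (ha : 0 < a) (hs : 0 < s + lam) :
    measureLaplace (dens (gammaKernel a lam)) s = ENNReal.ofReal ((s + lam) ^ (-a)) := by
  have hG := Real.Gamma_pos_of_pos ha
  have h0 := Real.integral_rpow_mul_exp_neg_mul_Ioi ha hs
  have hpos : 0 < ∫ t in Ioi (0 : ℝ), t ^ (a - 1) * Real.exp (-((s + lam) * t)) := by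
    rw [h0]; positivity
  have hint := Integrable.of_integral_ne_zero hpos.ne'
  rw [measureLaplace_dens (continuousOn_gammaKernel a lam)]
  have : ∀ t : ℝ, Real.exp (-s * t) * gammaKernel a lam t =
      t ^ (a - 1) * Real.exp (-((s + lam) * t)) / Real.Gamma a := by
    intro t
    rw [gammaKernel, show -((s + lam) * t) = -s * t + -lam * t by ring, Real.exp_add]
    ring
  simp_rw [this]
  rw [← ofReal_integral_eq_lintegral_ofReal (hint.div_const _), integral_div, h0,
    mul_div_cancel_right₀ _ hG.ne', one_div, Real.inv_rpow hs.le, Real.rpow_neg hs.le]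
  filter_upwards [ae_restrict_mem measurableSet_Ioi] with t ht
  have : (0 : ℝ) < t := ht
  simp only [Pi.zero_apply]
  positivity

section LevyTail

variable {β lam : ℝ}

lemma integrableOn_levyDensity (hβ : 0 < β) (hlam : 0 ≤ lam) {t : ℝ} (ht : 0 < t) :
    IntegrableOn (fun r : ℝ => Real.exp (-lam * r) * (β * r ^ (-β - 1))) (Ioi t) := by
  refine Integrable.mono'
    ((integrableOn_Ioi_rpow_of_lt (by linarith : -β - 1 < -1) ht).const_mul β) ?_ ?_
  · exact (by fun_prop : Measurable fun r : ℝ =>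
      Real.exp (-lam * r) * (β * r ^ (-β - 1))).aestronglyMeasurable
  · filter_upwards [ae_restrict_mem measurableSet_Ioi] with r hr
    have hr0 : 0 < r := ht.trans hr
    rw [Real.norm_of_nonneg (by positivity)]
    refine mul_le_of_le_one_left (by positivity) (Real.exp_le_one_iff.2 ?_)
    nlinarith

lemma levyTail_nonneg (hβ : 0 < β) (hβ1 : β < 1) {t : ℝ} (ht : 0 < t) :
    0 ≤ levyTail β lam t := by
  have := Real.Gamma_pos_of_pos (sub_pos.2 hβ1)
  refine mul_nonneg (by positivity) (setIntegral_nonneg measurableSet_Ioi fun r hr => ?_)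
  have : 0 < r := ht.trans hr
  positivity

lemma levyTail_le (hβ : 0 < β) (hβ1 : β < 1) (hlam : 0 ≤ lam) {t : ℝ} (ht : 0 < t) :
    levyTail β lam t ≤ t ^ (-β) / Real.Gamma (1 - β) := by
  have hG := Real.Gamma_pos_of_pos (sub_pos.2 hβ1)
  have h1 : ∫ r in Ioi t, Real.exp (-lam * r) * (β * r ^ (-β - 1)) ≤ t ^ (-β) := by
    have h2 : ∫ r in Ioi t, β * r ^ (-β - 1) = t ^ (-β) := by
      rw [integral_const_mul, integral_Ioi_rpow_of_lt (by linarith) ht, sub_add_cancel]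
      field_simp
    rw [← h2]
    refine setIntegral_mono_on (integrableOn_levyDensity hβ hlam ht)
      ((integrableOn_Ioi_rpow_of_lt (by linarith) ht).const_mul β) measurableSet_Ioi fun r hr => ?_
    have hr0 : 0 < r := ht.trans hr
    refine mul_le_of_le_one_left (by positivity) (Real.exp_le_one_iff.2 ?_)
    nlinarith
  rw [levyTail, one_div, ← div_eq_inv_mul]
  gcongr

lemma continuousOn_levyTail (hβ : 0 < β) (hlam : 0 ≤ lam) :
    ContinuousOn (levyTail β lam) (Ioi 0) := by
  intro t ht
  have ht0 : 0 < t := ht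
  refine ContinuousAt.continuousWithinAt ?_
  unfold levyTail
  refine ContinuousAt.const_mul ?_ _
  set f : ℝ → ℝ := fun r => Real.exp (-lam * r) * (β * r ^ (-β - 1)) with hf
  have hint := integrableOn_levyDensity hβ hlam (half_pos ht0)
  have heq : (fun u => ∫ r in Ioi u, f r) =ᶠ[𝓝 t]
      fun u => (∫ r in Ioi (t / 2), f r) - ∫ r in (t / 2)..u, f r := by
    filter_upwards [Ioi_mem_nhds (half_lt_self ht0)] with u hu
    rw [eq_sub_iff_add_eq, add_comm]
    exact intervalIntegral.integral_interval_add_Ioi hint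
      (hint.mono_set (Ioi_subset_Ioi (le_of_lt hu)))
  refine ContinuousAt.congr (ContinuousAt.sub continuousAt_const ?_) heq.symm
  have hii : IntervalIntegrable f volume (t / 2) (t + 1) := by
    rw [intervalIntegrable_iff_integrableOn_Ioc_of_le (by linarith)]
    exact hint.mono_set Ioc_subset_Ioi_self
  have := intervalIntegral.continuousOn_primitive_interval' hii left_mem_uIcc
  refine this.continuousAt ?_
  rw [uIcc_of_le (by linarith)]
  exact Icc_mem_nhds (by linarith) (by linarith)

lemma lintegral_exp_neg_mul_Ioo {s r : ℝ} (hs : 0 < s) (hr : 0 < r) :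
    ∫⁻ t in Ioo 0 r, ENNReal.ofReal (Real.exp (-(s * t))) =
      ENNReal.ofReal ((1 - Real.exp (-(s * r))) / s) := by
  have hint : IntegrableOn (fun t => Real.exp (-(s * t))) (Ioo 0 r) :=
    (Continuous.integrableOn_Icc (by fun_prop)).mono_set Ioo_subset_Icc_self
  rw [← ofReal_integral_eq_lintegral_ofReal hint (ae_of_all _ fun _ => (Real.exp_pos _).le),
    ← integral_Ioc_eq_integral_Ioo, ← intervalIntegral.integral_of_le hr.le]
  congr 1
  rw [intervalIntegral.integral_eq_sub_of_hasDerivAt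
    (f := fun t => -Real.exp (-(s * t)) / s) (fun t _ => ?_)
    ((by fun_prop : Continuous fun t => Real.exp (-(s * t))).intervalIntegrable _ _)]
  · simp; ring
  · have h := (((hasDerivAt_id t).const_mul s).neg.exp.neg).div_const s
    refine h.congr_deriv ?_
    simp
    field_simp

lemma symbol_zero (β lam : ℝ) : symbol β lam 0 = 0 := by simp [symbol]

lemma symbol_pos (hβ : 0 < β) (hlam : 0 ≤ lam) {s : ℝ} (hs : 0 < s) : 0 < symbol β lam s :=
  sub_pos.2 (Real.rpow_lt_rpow hlam (by linarith) hβ)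

lemma lintegral_rpow_shift (hβ : 0 < β) (hlam : 0 ≤ lam) {s : ℝ} (hs : 0 < s) :
    ∫⁻ a in Ioo 0 s, ENNReal.ofReal (β * (a + lam) ^ (β - 1)) =
      ENNReal.ofReal (symbol β lam s) := by
  have hcont : ContinuousOn (fun a : ℝ => (a + lam) ^ β) (Icc 0 s) := by
    refine ContinuousOn.rpow_const (by fun_prop) fun x _ => Or.inr hβ.le
  have hder : ∀ a ∈ Ioo (0 : ℝ) s,
      HasDerivAt (fun a : ℝ => (a + lam) ^ β) (β * (a + lam) ^ (β - 1)) a := by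
    intro a ha
    have h := ((hasDerivAt_id a).add_const lam).rpow_const (p := β)
      (Or.inl (by simp only [id]; linarith [ha.1]))
    simpa using h
  have hnn : ∀ a ∈ Ioo (0 : ℝ) s, 0 ≤ β * (a + lam) ^ (β - 1) := fun a ha => by
    have : 0 < a + lam := by linarith [ha.1]
    positivity
  -- For `lam = 0` the integrand is unbounded at 0; integrability comes from its sign and the
  -- continuity of the antiderivative up to the endpoint.
  have hint : IntegrableOn (fun a : ℝ => β * (a + lam) ^ (β - 1)) (Ioc 0 s) :=
    intervalIntegral.integrableOn_deriv_of_nonneg hcont hder hnn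
  rw [← ofReal_integral_eq_lintegral_ofReal (hint.mono_set Ioo_subset_Ioc_self)
    ((ae_restrict_mem measurableSet_Ioo).mono hnn),
    ← integral_Ioc_eq_integral_Ioo, ← intervalIntegral.integral_of_le hs.le,
    intervalIntegral.integral_eq_sub_of_hasDerivAt_of_le hs.le hcont hder
      ((intervalIntegrable_iff_integrableOn_Ioc_of_le hs.le).2 hint)]
  simp [symbol]

lemma lintegral_Ioi_Ioi_swap {F : ℝ → ℝ → ℝ≥0∞} (hF : Measurable (Function.uncurry F)) :
    ∫⁻ t in Ioi 0, ∫⁻ r in Ioi t, F t r = ∫⁻ r in Ioi 0, ∫⁻ t in Ioo 0 r, F t r := by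
  have hS : MeasurableSet {p : ℝ × ℝ | 0 < p.1 ∧ p.1 < p.2} :=
    (measurableSet_lt measurable_const measurable_fst).inter
      (measurableSet_lt measurable_fst measurable_snd)
  have hm : Measurable ({p : ℝ × ℝ | 0 < p.1 ∧ p.1 < p.2}.indicator (Function.uncurry F)) :=
    hF.indicator hS
  calc _ = ∫⁻ t, ∫⁻ r, {p : ℝ × ℝ | 0 < p.1 ∧ p.1 < p.2}.indicator (Function.uncurry F) (t, r) := by
        rw [← lintegral_indicator measurableSet_Ioi]
        congr with t
        by_cases ht : t ∈ Ioi (0 : ℝ)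
        · rw [indicator_of_mem ht, ← lintegral_indicator measurableSet_Ioi]
          have ht' : 0 < t := ht
          congr with r
          simp [indicator, ht', Function.uncurry]
        · have ht' : ¬ 0 < t := ht
          simp [indicator, ht']
    _ = ∫⁻ r, ∫⁻ t, {p : ℝ × ℝ | 0 < p.1 ∧ p.1 < p.2}.indicator (Function.uncurry F) (t, r) :=
        lintegral_lintegral_swap (f := fun t r =>
          {p : ℝ × ℝ | 0 < p.1 ∧ p.1 < p.2}.indicator (Function.uncurry F) (t, r)) hm.aemeasurable
    _ = _ := by
        rw [← lintegral_indicator measurableSet_Ioi]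
        congr with r
        by_cases hr : r ∈ Ioi (0 : ℝ)
        · rw [indicator_of_mem hr, ← lintegral_indicator measurableSet_Ioo]
          congr with t
        · rw [indicator_of_notMem hr]
          have : ∀ t, ¬ (0 < t ∧ t < r) := fun t h => hr (h.1.trans h.2)
          simp [indicator, this]

lemma ofReal_levyTail (hβ : 0 < β) (hβ1 : β < 1) (hlam : 0 ≤ lam) {t : ℝ} (ht : 0 < t) :
    ENNReal.ofReal (levyTail β lam t) = ∫⁻ r in Ioi t,
      ENNReal.ofReal (1 / Real.Gamma (1 - β) * (Real.exp (-lam * r) * (β * r ^ (-β - 1)))) := by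
  have hG := Real.Gamma_pos_of_pos (sub_pos.2 hβ1)
  rw [levyTail, ← integral_const_mul,
    ofReal_integral_eq_lintegral_ofReal ((integrableOn_levyDensity hβ hlam ht).const_mul _)]
  filter_upwards [ae_restrict_mem measurableSet_Ioi] with r hr
  have : 0 < r := ht.trans hr
  simp only [Pi.zero_apply]
  positivity

/-- Tonelli brings in 1 - e^{-sr} = s ∫₀^r e^{-st} dt, which also equals r ∫₀^s e^{-ar} da. The
second form trades r^{-β-1} for r^{-β}, the Gamma kernel of index 1 - β, whose transform (a +
λ)^{β-1} integrates to the symbol. All steps are between nonnegative integrals. -/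
lemma measureLaplace_levyTail (hβ : 0 < β) (hβ1 : β < 1) (hlam : 0 ≤ lam) {s : ℝ} (hs : 0 < s) :
    measureLaplace (dens (levyTail β lam)) s = ENNReal.ofReal (symbol β lam s / s) := by
  have hG := Real.Gamma_pos_of_pos (sub_pos.2 hβ1)
  have hswap : ∀ r : ℝ, 0 < r → ENNReal.ofReal s * (ENNReal.ofReal
        (1 / Real.Gamma (1 - β) * (Real.exp (-lam * r) * (β * r ^ (-β - 1)))) *
        ∫⁻ t in Ioo 0 r, ENNReal.ofReal (Real.exp (-(s * t)))) =
      ENNReal.ofReal β * ∫⁻ a in Ioo 0 s, ENNReal.ofReal (Real.exp (-a * r) *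
        gammaKernel (1 - β) lam r) := by
    intro r hr
    have h1 : ∀ a : ℝ, ENNReal.ofReal (Real.exp (-a * r) * gammaKernel (1 - β) lam r) =
        ENNReal.ofReal (Real.exp (-(r * a))) * ENNReal.ofReal (gammaKernel (1 - β) lam r) := by
      intro a
      rw [ENNReal.ofReal_mul (Real.exp_pos _).le]
      ring_nf
    simp_rw [h1]
    rw [lintegral_mul_const _ (by fun_prop), lintegral_exp_neg_mul_Ioo hs hr,
      lintegral_exp_neg_mul_Ioo hr hs]
    have hk := gammaKernel_nonneg (lam := lam) (sub_pos.2 hβ1) hr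
    have he : 0 ≤ 1 - Real.exp (-(r * s)) := by
      have : 0 < r * s := by positivity
      rw [sub_nonneg, Real.exp_le_one_iff]
      linarith
    rw [← ENNReal.ofReal_mul (by positivity), ← ENNReal.ofReal_mul hs.le,
      ← ENNReal.ofReal_mul (by positivity), ← ENNReal.ofReal_mul hβ.le]
    congr 1
    have hp : r ^ (-β - 1) = r ^ (-β) / r := Real.rpow_sub_one hr.ne' _
    rw [gammaKernel, hp, show 1 - β - 1 = -β by ring, mul_comm s r]
    field_simp
  rw [measureLaplace_dens (continuousOn_levyTail hβ hlam)]
  have hs' : ENNReal.ofReal s ≠ 0 := by simpa using hs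
  rw [ENNReal.ofReal_div_of_pos hs, ENNReal.eq_div_iff hs' ENNReal.ofReal_ne_top]
  calc ENNReal.ofReal s * ∫⁻ t in Ioi 0, ENNReal.ofReal (Real.exp (-s * t) * levyTail β lam t)
      = ENNReal.ofReal s * ∫⁻ t in Ioi 0, ∫⁻ r in Ioi t,
          ENNReal.ofReal (1 / Real.Gamma (1 - β) * (Real.exp (-lam * r) * (β * r ^ (-β - 1)))) *
          ENNReal.ofReal (Real.exp (-(s * t))) := by
        congr 1
        refine setLIntegral_congr_fun measurableSet_Ioi fun t ht => ?_
        rw [lintegral_mul_const _ (by fun_prop), ← ofReal_levyTail hβ hβ1 hlam ht,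
          ENNReal.ofReal_mul (Real.exp_pos _).le, mul_comm, neg_mul]
    _ = ∫⁻ r in Ioi 0, ENNReal.ofReal β * ∫⁻ a in Ioo 0 s, ENNReal.ofReal (Real.exp (-a * r) *
        gammaKernel (1 - β) lam r) := by
        rw [lintegral_Ioi_Ioi_swap (by unfold Function.uncurry; fun_prop),
          ← lintegral_const_mul' _ _ ENNReal.ofReal_ne_top]
        refine setLIntegral_congr_fun measurableSet_Ioi fun r hr => ?_
        rw [lintegral_const_mul _ (by fun_prop), hswap r hr]
    _ = ENNReal.ofReal β * ∫⁻ a in Ioo 0 s, measureLaplace (dens (gammaKernel (1 - β) lam)) a := by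
        rw [lintegral_const_mul' _ _ ENNReal.ofReal_ne_top, lintegral_lintegral_swap]
        · simp_rw [measureLaplace_dens (continuousOn_gammaKernel (1 - β) lam)]
        · unfold gammaKernel Function.uncurry; fun_prop
    _ = ∫⁻ a in Ioo 0 s, ENNReal.ofReal (β * (a + lam) ^ (β - 1)) := by
        rw [← lintegral_const_mul' _ _ ENNReal.ofReal_ne_top]
        refine setLIntegral_congr_fun measurableSet_Ioo fun a ha => ?_
        rw [measureLaplace_gammaKernel (sub_pos.2 hβ1) (by linarith [ha.1]),
          ENNReal.ofReal_mul hβ.le, neg_sub]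
    _ = _ := lintegral_rpow_shift hβ hlam hs

end LevyTail

/-! ### Convolution of functions with power singularities at the origin -/

/-- The function is the norm of the integrand of a complex Beta integral. -/
lemma integrableOn_rpow_mul_one_sub_rpow {p q : ℝ} (hp : -1 < p) (hq : -1 < q) :
    IntegrableOn (fun w : ℝ => (1 - w) ^ p * w ^ q) (Ioo 0 1) := by
  have h := Complex.betaIntegral_convergent (u := ((q + 1 : ℝ) : ℂ)) (v := ((p + 1 : ℝ) : ℂ))
    (by simp; linarith) (by simp; linarith)
  rw [intervalIntegrable_iff_integrableOn_Ioo_of_le zero_le_one] at h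
  refine IntegrableOn.congr_fun (Integrable.norm h) (fun w hw => ?_) measurableSet_Ioo
  have h0 : 0 < w := hw.1
  have h1 : 0 < 1 - w := sub_pos.2 hw.2
  have e1 : ((q + 1 : ℝ) : ℂ) - 1 = ((q : ℝ) : ℂ) := by push_cast; ring
  have e2 : ((p + 1 : ℝ) : ℂ) - 1 = ((p : ℝ) : ℂ) := by push_cast; ring
  have e3 : (1 : ℂ) - (w : ℂ) = ((1 - w : ℝ) : ℂ) := by push_cast; ring
  rw [e1, e2, e3, norm_mul, Complex.norm_cpow_eq_rpow_re_of_pos h0,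
    Complex.norm_cpow_eq_rpow_re_of_pos h1, Complex.ofReal_re, Complex.ofReal_re, mul_comm]

/-- The convolution of two functions on `(0, ∞)`. -/
noncomputable def halfConv (a b : ℝ → ℝ) (t : ℝ) : ℝ := ∫ y in (0 : ℝ)..t, a (t - y) * b y

section

variable {a b : ℝ → ℝ} {p q A B T : ℝ}

lemma norm_mul_le_of_rpow_bound (ha' : ∀ r ∈ Ioc 0 T, |a r| ≤ A * r ^ p)
    (hb' : ∀ r ∈ Ioc 0 T, |b r| ≤ B * r ^ q) {t w : ℝ} (ht : t ∈ Ioc 0 T) (hw : w ∈ Ioo 0 1) :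
    ‖a (t * (1 - w)) * b (t * w)‖ ≤ A * B * t ^ (p + q) * ((1 - w) ^ p * w ^ q) := by
  have h0 : 0 < w := hw.1
  have h1 : 0 < 1 - w := sub_pos.2 hw.2
  have ht0 : 0 < t := ht.1
  have hm1 : t * (1 - w) ∈ Ioc 0 T := ⟨by positivity, by nlinarith [ht.2]⟩
  have hm2 : t * w ∈ Ioc 0 T := ⟨by positivity, by nlinarith [ht.2, hw.2]⟩
  rw [norm_mul, Real.norm_eq_abs, Real.norm_eq_abs]
  have hA := ha' _ hm1
  have hB := hb' _ hm2
  calc |a (t * (1 - w))| * |b (t * w)| ≤ (A * (t * (1 - w)) ^ p) * (B * (t * w) ^ q) :=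
        mul_le_mul hA hB (abs_nonneg _) ((abs_nonneg _).trans hA)
    _ = _ := by
      rw [Real.mul_rpow ht0.le h1.le, Real.mul_rpow ht0.le h0.le, Real.rpow_add ht0]
      ring

lemma continuousOn_mul_comp (ha : ContinuousOn a (Ioi 0)) (hb : ContinuousOn b (Ioi 0)) {t : ℝ}
    (ht : 0 < t) : ContinuousOn (fun w => a (t * (1 - w)) * b (t * w)) (Ioo 0 1) := by
  refine ContinuousOn.mul (ha.comp (by fun_prop) fun w hw => ?_)
    (hb.comp (by fun_prop) fun w hw => ?_)
  · exact mul_pos ht (sub_pos.2 hw.2)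
  · exact mul_pos ht hw.1

lemma integrableOn_mul_comp (hp : -1 < p) (hq : -1 < q) (ha : ContinuousOn a (Ioi 0))
    (hb : ContinuousOn b (Ioi 0)) (ha' : ∀ r ∈ Ioc 0 T, |a r| ≤ A * r ^ p)
    (hb' : ∀ r ∈ Ioc 0 T, |b r| ≤ B * r ^ q) {t : ℝ} (ht : t ∈ Ioc 0 T) :
    IntegrableOn (fun w => a (t * (1 - w)) * b (t * w)) (Ioo 0 1) := by
  refine Integrable.mono' ((integrableOn_rpow_mul_one_sub_rpow hp hq).const_mul
    (A * B * t ^ (p + q)))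
    ((continuousOn_mul_comp ha hb ht.1).aestronglyMeasurable measurableSet_Ioo) ?_
  filter_upwards [ae_restrict_mem measurableSet_Ioo] with w hw
  exact norm_mul_le_of_rpow_bound ha' hb' ht hw

/-- Rescaling y = tw fixes the domain of integration. Power bounds on the factors then separate into
a power of t times a Beta integrand in w, which serves as a dominating function for continuity in t.
-/
lemma halfConv_eq (t : ℝ) :
    halfConv a b t = t * ∫ w in Ioo 0 1, a (t * (1 - w)) * b (t * w) := by
  have h := intervalIntegral.mul_integral_comp_mul_left (a := 0) (b := 1)
    (f := fun y => a (t - y) * b y) (c := t)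
  rw [mul_zero, mul_one] at h
  rw [halfConv, ← h, intervalIntegral.integral_of_le zero_le_one, integral_Ioc_eq_integral_Ioo]
  congr with w
  ring_nf

lemma continuousOn_halfConv (hp : -1 < p) (hq : -1 < q) (ha : ContinuousOn a (Ioi 0))
    (hb : ContinuousOn b (Ioi 0)) (ha' : ∀ r ∈ Ioc 0 T, |a r| ≤ A * r ^ p)
    (hb' : ∀ r ∈ Ioc 0 T, |b r| ≤ B * r ^ q) : ContinuousOn (halfConv a b) (Ioo 0 T) := by
  intro t ht
  refine ContinuousAt.continuousWithinAt ?_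
  have ht0 : 0 < t := ht.1
  have hnear : ∀ᶠ x in 𝓝 t, x ∈ Ioo (t / 2) T := Ioo_mem_nhds (by linarith) ht.2
  have heq : (fun x => x * ∫ w in Ioo 0 1, a (x * (1 - w)) * b (x * w)) =ᶠ[𝓝 t] halfConv a b := by
    filter_upwards [hnear] with x hx
    exact (halfConv_eq x).symm
  refine ContinuousAt.congr (continuousAt_id.mul ?_) heq
  obtain ⟨M, hM⟩ : ∃ M, ∀ x ∈ Icc (t / 2) T, ‖A * B * x ^ (p + q)‖ ≤ M := by
    refine isCompact_Icc.exists_bound_of_continuousOn (ContinuousOn.mul (by fun_prop)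
      (ContinuousOn.rpow_const (by fun_prop) fun x hx => Or.inl ?_))
    have := hx.1
    linarith
  refine continuousAt_of_dominated (bound := fun w => M * ((1 - w) ^ p * w ^ q)) ?_ ?_
    ((integrableOn_rpow_mul_one_sub_rpow hp hq).const_mul M) ?_
  · filter_upwards [hnear] with x hx
    exact (continuousOn_mul_comp ha hb (by linarith [hx.1])).aestronglyMeasurable measurableSet_Ioo
  · filter_upwards [hnear] with x hx
    filter_upwards [ae_restrict_mem measurableSet_Ioo] with w hw
    refine (norm_mul_le_of_rpow_bound ha' hb' ⟨by linarith [hx.1], hx.2.le⟩ hw).trans ?_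
    have h0 : 0 < w := hw.1
    have h1 : 0 < 1 - w := sub_pos.2 hw.2
    refine mul_le_mul_of_nonneg_right ?_ (by positivity)
    exact (le_abs_self _).trans (hM x ⟨hx.1.le, hx.2.le⟩)
  · filter_upwards [ae_restrict_mem measurableSet_Ioo] with w hw
    have h0 : 0 < w := hw.1
    have h1 : 0 < 1 - w := sub_pos.2 hw.2
    have hc1 : ContinuousAt a (t * (1 - w)) := ha.continuousAt (Ioi_mem_nhds (by positivity))
    have hc2 : ContinuousAt b (t * w) := hb.continuousAt (Ioi_mem_nhds (by positivity))
    exact ContinuousAt.mul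
      (ContinuousAt.comp (f := fun x => x * (1 - w)) (x := t) hc1 (by fun_prop))
      (ContinuousAt.comp (f := fun x => x * w) (x := t) hc2 (by fun_prop))

lemma abs_halfConv_le (hp : -1 < p) (hq : -1 < q)
    (ha' : ∀ r ∈ Ioc 0 T, |a r| ≤ A * r ^ p)
    (hb' : ∀ r ∈ Ioc 0 T, |b r| ≤ B * r ^ q) {t : ℝ} (ht : t ∈ Ioc 0 T) :
    |halfConv a b t| ≤ A * B * t ^ (p + q + 1) * ∫ w in Ioo 0 1, (1 - w) ^ p * w ^ q := by
  have ht0 : 0 < t := ht.1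
  rw [halfConv_eq t, abs_mul, abs_of_pos ht0, Real.rpow_add_one ht0.ne',
    show A * B * (t ^ (p + q) * t) * ∫ w in Ioo (0 : ℝ) 1, (1 - w) ^ p * w ^ q =
      t * ((A * B * t ^ (p + q)) * ∫ w in Ioo (0 : ℝ) 1, (1 - w) ^ p * w ^ q) by ring,
    ← integral_const_mul]
  refine mul_le_mul_of_nonneg_left ?_ ht0.le
  rw [← Real.norm_eq_abs]
  refine norm_integral_le_of_norm_le ((integrableOn_rpow_mul_one_sub_rpow hp hq).const_mul _) ?_
  filter_upwards [ae_restrict_mem measurableSet_Ioo] with w hw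
  exact norm_mul_le_of_rpow_bound ha' hb' ht hw

lemma integrableOn_halfConv (hp : -1 < p) (hq : -1 < q) (ha : ContinuousOn a (Ioi 0))
    (hb : ContinuousOn b (Ioi 0)) (ha' : ∀ r ∈ Ioc 0 T, |a r| ≤ A * r ^ p)
    (hb' : ∀ r ∈ Ioc 0 T, |b r| ≤ B * r ^ q) {t : ℝ} (ht : t ∈ Ioc 0 T) :
    IntegrableOn (fun y => a (t - y) * b y) (Ioo 0 t) := by
  have ht0 : 0 < t := ht.1
  have h := integrableOn_mul_comp hp hq ha hb ha' hb' ht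
  rw [← intervalIntegrable_iff_integrableOn_Ioo_of_le zero_le_one] at h
  rw [← intervalIntegrable_iff_integrableOn_Ioo_of_le ht0.le]
  have h2 := h.comp_mul_left (c := t⁻¹)
  rw [zero_div, one_div, inv_inv] at h2
  refine h2.congr fun y _ => ?_
  have e1 : t * (1 - t⁻¹ * y) = t - y := by field_simp
  have e2 : t * (t⁻¹ * y) = y := by field_simp
  simp only [e1, e2]

lemma lintegral_halfLine_sub_dens (ha : ContinuousOn a (Ioi 0)) (hb : ContinuousOn b (Ioi 0))
    (ha0 : ∀ r, 0 < r → 0 ≤ a r) (t : ℝ) :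
    ∫⁻ y, halfLine a (t - y) ∂dens b = ∫⁻ y in Ioo 0 t, ENNReal.ofReal (a (t - y) * b y) := by
  have := measurable_halfLine ha
  rw [dens, lintegral_withDensity_eq_lintegral_mul _ (measurable_halfLine hb) (by fun_prop),
    ← lintegral_indicator measurableSet_Ioo]
  congr with y
  rw [Pi.mul_apply]
  by_cases hy : y ∈ Ioo 0 t
  · rw [indicator_of_mem hy, halfLine_of_pos hy.1, halfLine_of_pos (sub_pos.2 hy.2),
      ENNReal.ofReal_mul (ha0 _ (sub_pos.2 hy.2)), mul_comm]
  · rw [indicator_of_notMem hy]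
    rcases le_or_gt y 0 with h | h
    · rw [halfLine_of_nonpos h, zero_mul]
    · rw [halfLine_of_nonpos (t := t - y), mul_zero]
      exact sub_nonpos.2 (not_lt.1 fun h' => hy ⟨h, h'⟩)

lemma lintegral_halfLine_sub_dens_eq_ofReal (ha : ContinuousOn a (Ioi 0))
    (hb : ContinuousOn b (Ioi 0)) (ha0 : ∀ r, 0 < r → 0 ≤ a r) (hb0 : ∀ r, 0 < r → 0 ≤ b r) {t : ℝ}
    (ht : 0 < t) (hint : IntegrableOn (fun y => a (t - y) * b y) (Ioo 0 t)) :
    ∫⁻ y, halfLine a (t - y) ∂dens b = ENNReal.ofReal (halfConv a b t) := by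
  rw [lintegral_halfLine_sub_dens ha hb ha0, halfConv, intervalIntegral.integral_of_le ht.le,
    integral_Ioc_eq_integral_Ioo, ofReal_integral_eq_lintegral_ofReal hint]
  filter_upwards [ae_restrict_mem measurableSet_Ioo] with y hy
  exact mul_nonneg (ha0 _ (sub_pos.2 hy.2)) (hb0 _ hy.1)

end

/-- Meant for the density of D(x) as second factor, for which only measurability and an almost
everywhere bound are available. -/
lemma integrableOn_halfConv_of_bounded {a b : ℝ → ℝ} {p A C t : ℝ} (hp : -1 < p) (ht : 0 < t)
    (ha : ContinuousOn a (Ioi 0)) (ha' : ∀ r, 0 < r → |a r| ≤ A * r ^ p)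
    (hb : AEStronglyMeasurable b (volume.restrict (Ioo 0 t)))
    (hb' : ∀ᵐ y ∂volume.restrict (Ioo 0 t), |b y| ≤ C) :
    IntegrableOn (fun y => a (t - y) * b y) (Ioo 0 t) := by
  have hA : 0 ≤ A := by simpa using (abs_nonneg _).trans (ha' 1 one_pos)
  have hmain : IntegrableOn (fun y => A * (t - y) ^ p * C) (Ioo 0 t) := by
    have h : IntervalIntegrable (fun y : ℝ => y ^ p) volume 0 t :=
      intervalIntegral.intervalIntegrable_rpow' hp
    have h2 := (h.comp_sub_left t).symm
    rw [sub_zero, sub_self] at h2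
    rw [intervalIntegrable_iff_integrableOn_Ioo_of_le ht.le] at h2
    exact (h2.const_mul A).mul_const C
  refine Integrable.mono' hmain (AEStronglyMeasurable.mul ?_ hb) ?_
  · refine ContinuousOn.aestronglyMeasurable (ha.comp (by fun_prop) fun y hy => ?_)
      measurableSet_Ioo
    exact sub_pos.2 hy.2
  · filter_upwards [ae_restrict_mem measurableSet_Ioo, hb'] with y hy hby
    rw [norm_mul, Real.norm_eq_abs, Real.norm_eq_abs]
    have hty : 0 < t - y := sub_pos.2 hy.2
    exact mul_le_mul (ha' _ hty) hby (abs_nonneg _) (by positivity)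

/-! ### A locally bounded density from the decay of the characteristic function -/

lemma integrable_exp_neg_mul_abs_rpow {c p : ℝ} (hc : 0 < c) (hp : 0 < p) :
    Integrable fun t : ℝ => Real.exp (-c * |t| ^ p) := by
  refine Integrable.of_integral_ne_zero (ne_of_gt ?_)
  rw [integral_comp_abs (f := fun t => Real.exp (-c * t ^ p)), integral_exp_neg_mul_rpow hp hc]
  have := Real.Gamma_pos_of_pos (by positivity : 0 < 1 / p + 1)
  positivity

/-- A power with exponent in `(0, 1)` maps the right half-plane into a sector. -/
lemma abs_im_rpow_mul_cos_le_re_cpow {β : ℝ} (hβ : 0 < β) (hβ1 : β < 1) {z : ℂ} (hz : 0 < z.re) :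
    |z.im| ^ β * Real.cos (β * (Real.pi / 2)) ≤ (z ^ (β : ℂ)).re := by
  have hz0 : z ≠ 0 := fun h => by simp [h] at hz
  have hcos : 0 ≤ Real.cos (β * (Real.pi / 2)) :=
    Real.cos_nonneg_of_neg_pi_div_two_le_of_le (by nlinarith [Real.pi_pos])
      (by nlinarith [Real.pi_pos])
  have harg : |z.arg| ≤ Real.pi / 2 := Complex.abs_arg_le_pi_div_two_iff.2 hz.le
  have hre : (z ^ (β : ℂ)).re = ‖z‖ ^ β * Real.cos (β * |z.arg|) := by
    rw [Complex.cpow_ofReal_re]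
    congr 1
    rcases abs_choice z.arg with h | h
    · rw [h, mul_comm]
    · rw [h, mul_neg, Real.cos_neg, mul_comm]
  rw [hre]
  refine mul_le_mul (Real.rpow_le_rpow (abs_nonneg _) (Complex.abs_im_le_norm z) hβ.le) ?_ hcos
    (by positivity)
  refine Real.cos_le_cos_of_nonneg_of_le_pi (by positivity) ?_ ?_
  · nlinarith [Real.pi_pos]
  · gcongr

/-- The formula exp(-xψ) continues analytically to the half-plane. On the imaginary axis the base 1
- it + λ of the power has positive real part, so the power stays in a sector and has real part at
least |t|^β cos(βπ/2). The cosine is positive because β < 1, and the characteristic function decays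
as a stretched exponential. -/
lemma integrable_charFun_expTilt {m : Measure ℝ} {β lam x : ℝ} (hβ : 0 < β) (hβ1 : β < 1)
    (hlam : 0 ≤ lam) (hx : 0 < x)
    (hm : ∀ s, 0 ≤ s → measureLaplace m s = ENNReal.ofReal (Real.exp (-x * symbol β lam s))) :
    Integrable (charFun (expTilt m)) := by
  have hfin : ∀ s, 0 < s → measureLaplace m s ≠ ∞ := fun s hs => by simp [hm s hs.le]
  have := isFiniteMeasure_expTilt (hfin 1 one_pos)
  set G : ℂ → ℂ := fun z =>
    Complex.exp (-x * ((1 - z + lam) ^ (β : ℂ) - ((lam ^ β : ℝ) : ℂ))) with hG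
  have hGan : AnalyticOnNhd ℂ G {z | z.re < 1} := by
    refine DifferentiableOn.analyticOnNhd (fun z hz => ?_)
      (isOpen_lt Complex.continuous_re continuous_const)
    have hz' : z.re < 1 := hz
    refine DifferentiableAt.differentiableWithinAt ?_
    refine DifferentiableAt.cexp (DifferentiableAt.const_mul (DifferentiableAt.sub_const ?_ _) _)
    refine DifferentiableAt.cpow (by fun_prop) (by fun_prop) (Or.inl ?_)
    simp
    linarith
  have hEq := eqOn_halfPlane (analyticOnNhd_complexMGF_expTilt hfin) hGan fun t ht => by
    rw [complexMGF_ofReal_expTilt, hm _ (by linarith), ENNReal.toReal_ofReal (Real.exp_pos _).le,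
      hG, Complex.ofReal_exp, symbol]
    simp only
    rw [Complex.ofReal_mul, Complex.ofReal_sub, Complex.ofReal_cpow (by linarith)]
    push_cast
    rfl
  set c := x * Real.cos (β * (Real.pi / 2)) with hc
  have hc0 : 0 < c := mul_pos hx (Real.cos_pos_of_mem_Ioo
    ⟨by nlinarith [Real.pi_pos], by nlinarith [Real.pi_pos]⟩)
  refine Integrable.mono' ((integrable_exp_neg_mul_abs_rpow hc0 hβ).const_mul
    (Real.exp (x * lam ^ β))) (by fun_prop) (ae_of_all _ fun t => ?_)
  rw [← complexMGF_id_mul_I, hEq (by simp : (t * Complex.I : ℂ).re < 1), hG, Complex.norm_exp,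
    ← Real.exp_add, Real.exp_le_exp]
  have hk := abs_im_rpow_mul_cos_le_re_cpow hβ hβ1 (z := 1 - t * Complex.I + lam)
    (by simp; linarith)
  have him : (1 - t * Complex.I + lam : ℂ).im = -t := by simp
  rw [him, abs_neg] at hk
  have hre : (-(x : ℂ) * ((1 - t * Complex.I + lam) ^ (β : ℂ) - ((lam ^ β : ℝ) : ℂ))).re =
      -x * (((1 - t * Complex.I + lam : ℂ) ^ (β : ℂ)).re - lam ^ β) := by
    rw [← Complex.ofReal_neg, Complex.re_ofReal_mul, Complex.sub_re, Complex.ofReal_re]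
  rw [hre, hc]
  nlinarith [mul_le_mul_of_nonneg_left hk hx.le]

/-- A measure whose exponential tilt has a bounded density has a locally bounded density. -/
lemma exists_rnDeriv_le_exp {m : Measure ℝ} [IsFiniteMeasure m] [IsFiniteMeasure (expTilt m)]
    (h : Integrable (charFun (expTilt m))) :
    m ≪ volume ∧ ∃ C : ℝ≥0, ∀ᵐ y, m.rnDeriv volume y ≤ C * ENNReal.ofReal (Real.exp y) := by
  obtain ⟨C, hC⟩ := exists_le_smul_volume_of_integrable_charFun h
  have hle : m ≤ volume.withDensity fun y => C * ENNReal.ofReal (Real.exp y) := by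
    refine Measure.le_iff.2 fun s hs => ?_
    rw [← withDensity_exp_expTilt m, withDensity_apply _ hs, withDensity_apply _ hs]
    refine (lintegral_mono' (Measure.restrict_mono subset_rfl hC) le_rfl).trans ?_
    rw [Measure.restrict_smul, lintegral_smul_measure, lintegral_const_mul _ (by fun_prop)]
    rfl
  have hac : m ≪ volume := hle.absolutelyContinuous.trans (withDensity_absolutelyContinuous _ _)
  refine ⟨hac, C, ?_⟩
  refine ae_le_of_forall_setLIntegral_le_of_sigmaFinite (Measure.measurable_rnDeriv _ _)
    fun s hs _ => ?_
  refine (Measure.setLIntegral_rnDeriv_le s).trans ?_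
  rw [← withDensity_apply _ hs]
  exact hle s

/-! ### Laws of the subordinator and the potential measure -/

/-- The law of `D x`, for a real index `x`. -/
noncomputable def law {Ω : Type*} [MeasurableSpace Ω] (D : ℝ≥0 → Ω → ℝ) (P : Measure Ω) (x : ℝ) :
    Measure ℝ := P.map (D x.toNNReal)

/-- The measure `e^{-μx} dx` on `(0, ∞)`. -/
noncomputable def expWeight (μ : ℝ) : Measure ℝ := dens fun x => Real.exp (-μ * x)

/-- The potential measure `∫_0^∞ e^{-μx} P(D x ∈ ·) dx`. -/
noncomputable def potential {Ω : Type*} [MeasurableSpace Ω] (D : ℝ≥0 → Ω → ℝ) (P : Measure Ω)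
    (μ : ℝ) : Measure ℝ := (expWeight μ).bind (law D P)

lemma continuousOn_exp_neg_mul (μ : ℝ) : ContinuousOn (fun x => Real.exp (-μ * x)) (Ioi 0) := by
  fun_prop

lemma lintegral_expWeight (μ : ℝ) {f : ℝ → ℝ≥0∞} (hf : Measurable f) :
    ∫⁻ x, f x ∂expWeight μ = ∫⁻ x in Ioi 0, ENNReal.ofReal (Real.exp (-μ * x)) * f x := by
  rw [expWeight, dens, lintegral_withDensity_eq_lintegral_mul _
    (measurable_halfLine (continuousOn_exp_neg_mul μ)) hf, ← lintegral_indicator measurableSet_Ioi]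
  congr with x
  by_cases hx : x ∈ Ioi (0 : ℝ)
  · rw [indicator_of_mem hx, Pi.mul_apply, halfLine_of_pos hx]
  · rw [indicator_of_notMem hx, Pi.mul_apply, halfLine_of_nonpos (not_lt.1 hx), zero_mul]

lemma integral_exp_neg_mul_Ioi {c : ℝ} (hc : 0 < c) (a : ℝ) :
    ∫ x in Ioi a, Real.exp (-c * x) = Real.exp (-c * a) / c := by
  rw [integral_exp_mul_Ioi (neg_lt_zero.2 hc)]
  field_simp

lemma lintegral_exp_neg_mul_Ioi {c : ℝ} (hc : 0 < c) (a : ℝ) :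
    ∫⁻ x in Ioi a, ENNReal.ofReal (Real.exp (-c * x)) =
      ENNReal.ofReal (Real.exp (-c * a) / c) := by
  rw [← integral_exp_neg_mul_Ioi hc, ofReal_integral_eq_lintegral_ofReal
    (integrableOn_exp_mul_Ioi (neg_lt_zero.2 hc) a) (ae_of_all _ fun _ => (Real.exp_pos _).le)]

lemma expWeight_eq_zero (μ : ℝ) {s : Set ℝ} (hs : volume (s ∩ Ioi 0) = 0) :
    expWeight μ s = 0 := by
  refine measure_mono_null (t := (s ∩ Ioi 0) ∪ Iic 0) (fun x hx => ?_) (measure_union_null ?_ ?_)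
  · rcases le_or_gt x 0 with h | h
    · exact Or.inr h
    · exact Or.inl ⟨hx, h⟩
  · exact withDensity_absolutelyContinuous _ _ hs
  · rw [expWeight, dens, withDensity_apply _ measurableSet_Iic]
    refine (setLIntegral_congr_fun measurableSet_Iic fun x hx => halfLine_of_nonpos hx).trans ?_
    simp

lemma ae_expWeight {μ : ℝ} {p : ℝ → Prop} (h : ∀ x, 0 < x → p x) : ∀ᵐ x ∂expWeight μ, p x := by
  refine expWeight_eq_zero μ ?_
  have : {x | p x}ᶜ ∩ Ioi 0 = ∅ := eq_empty_of_forall_notMem fun x hx => hx.1 (h x hx.2)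
  rw [this, measure_empty]

namespace IsSubordinator

variable {Ω : Type*} [MeasurableSpace Ω] {P : Measure Ω}
  {β lam : ℝ} {D : ℝ≥0 → Ω → ℝ}

lemma ae_nonneg (hD : IsSubordinator β lam D P) : ∀ᵐ ω ∂P, ∀ x, 0 ≤ D x ω := by
  filter_upwards [hD.zero, hD.mono] with ω h0 hm x
  rw [← h0]
  exact hm zero_le

lemma law_Iio_zero (hD : IsSubordinator β lam D P) (x : ℝ) : law D P x (Iio 0) = 0 := by
  rw [law, Measure.map_apply (hD.measurable _) measurableSet_Iio, ← nonpos_iff_eq_zero]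
  refine (measure_mono_ae ?_).trans (measure_empty (μ := P)).le
  filter_upwards [hD.ae_nonneg] with ω h hω
  exact absurd hω (not_lt.2 (h _))

lemma measureLaplace_law (hD : IsSubordinator β lam D P) {x : ℝ} (hx : 0 ≤ x) {s : ℝ}
    (hs : 0 ≤ s) :
    measureLaplace (law D P x) s = ENNReal.ofReal (Real.exp (-x * symbol β lam s)) := by
  have h := hD.laplace x.toNNReal s hs
  rw [Real.coe_toNNReal _ hx] at h
  have hint : Integrable (fun ω => Real.exp (-s * D x.toNNReal ω)) P :=
    Integrable.of_integral_ne_zero (h ▸ (Real.exp_pos _).ne')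
  rw [measureLaplace, law, lintegral_map (by fun_prop) (hD.measurable _), ← h,
    ofReal_integral_eq_lintegral_ofReal hint (ae_of_all _ fun _ => (Real.exp_pos _).le)]

lemma antitone_law_Iic (hD : IsSubordinator β lam D P) (t : ℝ) :
    Antitone fun x => law D P x (Iic t) := by
  intro x y hxy
  simp only [law]
  rw [Measure.map_apply (hD.measurable _) measurableSet_Iic,
    Measure.map_apply (hD.measurable _) measurableSet_Iic]
  refine measure_mono_ae ?_
  filter_upwards [hD.mono] with ω h hω
  exact (h (Real.toNNReal_mono hxy)).trans hω

variable [IsProbabilityMeasure P]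

lemma isProbabilityMeasure_law (hD : IsSubordinator β lam D P) (x : ℝ) :
    IsProbabilityMeasure (law D P x) :=
  Measure.isProbabilityMeasure_map (hD.measurable _).aemeasurable

/-- Monotone paths make every distribution function monotone in x, hence measurable, and half-lines
form a generating π-system. This makes the laws a kernel, as the definition of the potential
requires. -/
lemma measurable_law (hD : IsSubordinator β lam D P) : Measurable (law D P) := by
  have := hD.isProbabilityMeasure_law
  refine Measurable.measure_of_isPiSystem_of_isProbabilityMeasure
    (BorelSpace.measurable_eq.trans (borel_eq_generateFrom_Iic ℝ)) isPiSystem_Iic ?_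
  rintro _ ⟨t, rfl⟩
  exact (hD.antitone_law_Iic t).measurable

lemma law_absolutelyContinuous (hD : IsSubordinator β lam D P) (hβ : 0 < β) (hβ1 : β < 1)
    (hlam : 0 ≤ lam) {x : ℝ} (hx : 0 < x) : law D P x ≪ volume ∧
      ∃ C : ℝ≥0, ∀ᵐ y, (law D P x).rnDeriv volume y ≤ C * ENNReal.ofReal (Real.exp y) := by
  have := hD.isProbabilityMeasure_law x
  have : IsFiniteMeasure (expTilt (law D P x)) :=
    isFiniteMeasure_expTilt (by simp [hD.measureLaplace_law hx.le zero_le_one])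
  exact exists_rnDeriv_le_exp (integrable_charFun_expTilt hβ hβ1 hlam hx
    fun s hs => hD.measureLaplace_law hx.le hs)

lemma lintegral_potential (hD : IsSubordinator β lam D P) (μ : ℝ) {f : ℝ → ℝ≥0∞}
    (hf : Measurable f) : ∫⁻ y, f y ∂potential D P μ =
      ∫⁻ x in Ioi 0, ENNReal.ofReal (Real.exp (-μ * x)) * ∫⁻ y, f y ∂law D P x := by
  rw [potential, Measure.lintegral_bind hD.measurable_law.aemeasurable hf.aemeasurable,
    lintegral_expWeight]
  exact (Measure.measurable_lintegral hf).comp hD.measurable_law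

/-- Integrate e^{-μx} e^{-xψ(s)} over x. The case s = 0 is kept because it gives the total mass. -/
lemma measureLaplace_potential (hD : IsSubordinator β lam D P) {μ s : ℝ} (hs : 0 ≤ s)
    (h : 0 < μ + symbol β lam s) :
    measureLaplace (potential D P μ) s = ENNReal.ofReal (1 / (μ + symbol β lam s)) := by
  rw [measureLaplace, hD.lintegral_potential μ (by fun_prop)]
  have := lintegral_exp_neg_mul_Ioi h 0
  rw [mul_zero, Real.exp_zero] at this
  rw [← this]
  refine setLIntegral_congr_fun measurableSet_Ioi fun x hx => ?_
  have h1 := hD.measureLaplace_law (le_of_lt hx) hs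
  rw [measureLaplace] at h1
  rw [h1, ← ENNReal.ofReal_mul (Real.exp_pos _).le, ← Real.exp_add]
  ring_nf

lemma isFiniteMeasure_potential (hD : IsSubordinator β lam D P) {μ : ℝ} (hμ : 0 < μ) :
    IsFiniteMeasure (potential D P μ) := by
  have h := hD.measureLaplace_potential (μ := μ) le_rfl (by rwa [symbol_zero, add_zero])
  simp only [measureLaplace, neg_zero, zero_mul, Real.exp_zero, ENNReal.ofReal_one,
    lintegral_const, one_mul] at h
  exact ⟨h ▸ ENNReal.ofReal_lt_top⟩

lemma potential_absolutelyContinuous (hD : IsSubordinator β lam D P) (hβ : 0 < β) (hβ1 : β < 1)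
    (hlam : 0 ≤ lam) (μ : ℝ) : potential D P μ ≪ volume := by
  refine Measure.AbsolutelyContinuous.mk fun s hs h0 => ?_
  rw [potential, Measure.bind_apply hs hD.measurable_law.aemeasurable]
  refine (lintegral_congr_ae (ae_expWeight fun x hx => ?_)).trans (lintegral_zero (μ := expWeight μ))
  exact (hD.law_absolutelyContinuous hβ hβ1 hlam hx).1 h0

lemma potential_Iic_zero (hD : IsSubordinator β lam D P) (hβ : 0 < β) (hβ1 : β < 1)
    (hlam : 0 ≤ lam) (μ : ℝ) : potential D P μ (Iic 0) = 0 := by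
  rw [potential, Measure.bind_apply measurableSet_Iic hD.measurable_law.aemeasurable]
  refine (lintegral_congr_ae (ae_expWeight fun x hx => ?_)).trans (lintegral_zero (μ := expWeight μ))
  rw [← Iio_union_right]
  exact measure_union_null (hD.law_Iio_zero x)
    ((hD.law_absolutelyContinuous hβ hβ1 hlam hx).1 (measure_singleton _))

end IsSubordinator

/-! ### The inverse process and its Laplace transform in terms of the potential -/

/-- The Laplace transform of a measure on `[0, ∞)` in terms of its distribution function, with
either convention at the jumps. -/
lemma measureLaplace_eq_mul_lintegral {ν : Measure ℝ} [SFinite ν] (hν : ν (Iio 0) = 0) {c : ℝ}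
    (hc : 0 < c) {R : Set (ℝ × ℝ)} (hR : MeasurableSet R)
    (h1 : ∀ x y, y < x → (x, y) ∈ R) (h2 : ∀ x y, (x, y) ∈ R → y ≤ x) :
    measureLaplace ν c = ENNReal.ofReal c *
      ∫⁻ x in Ioi 0, ENNReal.ofReal (Real.exp (-c * x)) * ν {y | (x, y) ∈ R} := by
  have hsec : ∀ x, MeasurableSet {y | (x, y) ∈ R} := fun x => measurable_prodMk_left hR
  have hm : Measurable fun p : ℝ × ℝ =>
      ENNReal.ofReal (Real.exp (-c * p.1)) * R.indicator (1 : ℝ × ℝ → ℝ≥0∞) p :=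
    Measurable.mul (by fun_prop) (measurable_one.indicator hR)
  have hinner : ∀ y, 0 ≤ y → ENNReal.ofReal (Real.exp (-c * y)) = ENNReal.ofReal c *
      ∫⁻ x in Ioi 0, ENNReal.ofReal (Real.exp (-c * x)) * R.indicator 1 (x, y) := by
    intro y hy
    -- Only the diagonal is left undetermined by the hypotheses on `R`, and each of its sections is
    -- a single point.
    have hae : ∀ᵐ x : ℝ ∂volume, x ≠ y := by simp [ae_iff]
    have : ∫⁻ x in Ioi 0, ENNReal.ofReal (Real.exp (-c * x)) * R.indicator 1 (x, y) =
        ∫⁻ x in Ioi y, ENNReal.ofReal (Real.exp (-c * x)) := by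
      rw [← lintegral_indicator measurableSet_Ioi, ← lintegral_indicator measurableSet_Ioi]
      refine lintegral_congr_ae ?_
      filter_upwards [hae] with x hxy
      by_cases hx : y < x
      · rw [indicator_of_mem (mem_Ioi.2 hx), indicator_of_mem (mem_Ioi.2 (hy.trans_lt hx)),
          indicator_of_mem (h1 _ _ hx), Pi.one_apply, mul_one]
      · have hn : (x, y) ∉ R := fun hr => hx (lt_of_le_of_ne (h2 _ _ hr) (Ne.symm hxy))
        rw [indicator_of_notMem (notMem_Ioi.2 (not_lt.1 hx))]
        simp [indicator, hn]
    rw [this, lintegral_exp_neg_mul_Ioi hc, ← ENNReal.ofReal_mul hc.le, mul_div_cancel₀ _ hc.ne']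
  calc measureLaplace ν c
      = ∫⁻ y, (ENNReal.ofReal c *
          ∫⁻ x in Ioi 0, ENNReal.ofReal (Real.exp (-c * x)) * R.indicator 1 (x, y)) ∂ν := by
        refine lintegral_congr_ae ?_
        have : ∀ᵐ y ∂ν, 0 ≤ y := by
          rw [ae_iff]; convert hν using 2; ext y; simp
        filter_upwards [this] with y hy using hinner y hy
    _ = ENNReal.ofReal c * ∫⁻ x in Ioi 0,
          ∫⁻ y, ENNReal.ofReal (Real.exp (-c * x)) * R.indicator 1 (x, y) ∂ν := by
        rw [lintegral_const_mul' _ _ ENNReal.ofReal_ne_top]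
        congr 1
        exact (lintegral_lintegral_swap (f := fun x y =>
          ENNReal.ofReal (Real.exp (-c * x)) * R.indicator 1 (x, y)) hm.aemeasurable).symm
    _ = _ := by
        congr 1
        refine lintegral_congr fun x => ?_
        rw [lintegral_const_mul' _ _ ENNReal.ofReal_ne_top]
        congr 1
        exact lintegral_indicator_one (hsec x)

lemma measureLaplace_eq_mul_lintegral_Iic {ν : Measure ℝ} [SFinite ν] (hν : ν (Iio 0) = 0) {c : ℝ}
    (hc : 0 < c) : measureLaplace ν c = ENNReal.ofReal c *
      ∫⁻ x in Ioi 0, ENNReal.ofReal (Real.exp (-c * x)) * ν (Iic x) :=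
  measureLaplace_eq_mul_lintegral hν hc (measurableSet_le measurable_snd measurable_fst)
    (fun _ _ h => le_of_lt h) fun _ _ h => h

lemma measureLaplace_eq_mul_lintegral_Iio {ν : Measure ℝ} [SFinite ν] (hν : ν (Iio 0) = 0) {c : ℝ}
    (hc : 0 < c) : measureLaplace ν c = ENNReal.ofReal c *
      ∫⁻ x in Ioi 0, ENNReal.ofReal (Real.exp (-c * x)) * ν (Iio x) :=
  measureLaplace_eq_mul_lintegral hν hc (measurableSet_lt measurable_snd measurable_fst)
    (fun _ _ h => h) fun _ _ h => le_of_lt h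

section Inverse

variable {Ω : Type*}

lemma inverse_nonneg (D : ℝ≥0 → Ω → ℝ) (t : ℝ) (ω : Ω) : 0 ≤ inverse D t ω := NNReal.coe_nonneg _

lemma inverse_le_of_lt {t : ℝ} {ω : Ω} {x : ℝ} (hx : 0 < x) (h : t < D x.toNNReal ω) :
    inverse D t ω ≤ x := by
  have : sInf {x : ℝ≥0 | 0 < x ∧ t < D x ω} ≤ x.toNNReal :=
    csInf_le (OrderBot.bddBelow _) ⟨Real.toNNReal_pos.2 hx, h⟩
  calc inverse D t ω ≤ (x.toNNReal : ℝ) := NNReal.coe_le_coe.2 this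
    _ = x := Real.coe_toNNReal _ hx.le

/-- Nonemptiness is essential: the infimum of the empty set is 0 in `ℝ≥0`, so a path that never
passes t would satisfy `h` for every positive x. -/
lemma exists_lt_of_inverse_lt {t : ℝ} {ω : Ω} {x : ℝ} (hne : ∃ x : ℝ≥0, 0 < x ∧ t < D x ω)
    (h : inverse D t ω < x) : ∃ y : ℝ≥0, 0 < y ∧ (y : ℝ) < x ∧ t < D y ω := by
  have hx : 0 < x := (inverse_nonneg D t ω).trans_lt h
  have h' : sInf {x : ℝ≥0 | 0 < x ∧ t < D x ω} < x.toNNReal := by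
    rw [← NNReal.coe_lt_coe, Real.coe_toNNReal _ hx.le]; exact h
  obtain ⟨y, hy, hyx⟩ := (csInf_lt_iff (OrderBot.bddBelow _) hne).1 h'
  refine ⟨y, hy.1, ?_, hy.2⟩
  rw [← Real.coe_toNNReal _ hx.le]
  exact NNReal.coe_lt_coe.2 hyx

end Inverse

namespace IsSubordinator

variable {Ω : Type*} [MeasurableSpace Ω] {P : Measure Ω} {β lam : ℝ} {D : ℝ≥0 → Ω → ℝ}

/-- The exponential Markov inequality at s = 1. As x → ∞ it forces the paths to pass every level
almost surely. -/
lemma law_Iic_le (hD : IsSubordinator β lam D P) {x : ℝ} (hx : 0 ≤ x) (t : ℝ) :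
    law D P x (Iic t) ≤ ENNReal.ofReal (Real.exp (t - x * symbol β lam 1)) := by
  have h := hD.measureLaplace_law hx zero_le_one
  calc law D P x (Iic t) = ∫⁻ y in Iic t, 1 ∂law D P x := by simp
    _ ≤ ∫⁻ y in Iic t, ENNReal.ofReal (Real.exp t) * ENNReal.ofReal (Real.exp (-1 * y))
          ∂law D P x := by
        refine setLIntegral_mono (by fun_prop) fun y hy => ?_
        rw [← ENNReal.ofReal_mul (Real.exp_pos _).le, ← Real.exp_add, ENNReal.one_le_ofReal]
        exact Real.one_le_exp (by have : y ≤ t := hy; linarith)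
    _ ≤ ∫⁻ y, ENNReal.ofReal (Real.exp t) * ENNReal.ofReal (Real.exp (-1 * y)) ∂law D P x :=
        setLIntegral_le_lintegral _ _
    _ = _ := by
        rw [lintegral_const_mul _ (by fun_prop)]
        rw [measureLaplace] at h
        rw [h, ← ENNReal.ofReal_mul (Real.exp_pos _).le, ← Real.exp_add]
        ring_nf

lemma ae_exists_lt (hD : IsSubordinator β lam D P) (hβ : 0 < β) (hlam : 0 ≤ lam) (t : ℝ) :
    ∀ᵐ ω ∂P, ∃ x : ℝ≥0, 0 < x ∧ t < D x ω := by
  have hψ := symbol_pos hβ hlam one_pos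
  have hlim : Tendsto (fun n : ℕ => ENNReal.ofReal
      (Real.exp (t - ((n : ℝ) + 1) * symbol β lam 1))) atTop (𝓝 0) := by
    rw [← ENNReal.ofReal_zero]
    refine (ENNReal.continuous_ofReal.tendsto 0).comp (Real.tendsto_exp_atBot.comp ?_)
    refine tendsto_atBot_add_const_left _ t (tendsto_neg_atTop_atBot.comp ?_)
    exact (tendsto_atTop_add_const_right _ 1 tendsto_natCast_atTop_atTop).atTop_mul_const hψ
  rw [ae_iff]
  refine nonpos_iff_eq_zero.1 (ge_of_tendsto' hlim fun n => ?_)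
  refine le_trans ?_ (hD.law_Iic_le (by positivity : (0 : ℝ) ≤ (n : ℝ) + 1) t)
  rw [law, Measure.map_apply (hD.measurable _) measurableSet_Iic]
  refine measure_mono fun ω hω => ?_
  by_contra hcon
  exact hω ⟨_, Real.toNNReal_pos.2 (by positivity), not_le.1 hcon⟩

/-- Off a null set, {E(t) < x} is the union over rational q in (0, x) of {D(q) > t}. Path regularity
holds only almost surely, hence the detour through null measurable sets. -/
lemma aemeasurable_inverse (hD : IsSubordinator β lam D P) (hβ : 0 < β) (hlam : 0 ≤ lam) (t : ℝ) :
    AEMeasurable (inverse D t) P := by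
  refine NullMeasurable.aemeasurable ?_
  refine @measurable_of_Iio ℝ (NullMeasurableSpace Ω P) _ _ _ _ _ _ _ _ fun x => ?_
  refine NullMeasurableSet.congr (s := ⋃ q ∈ {q : ℚ | 0 < (q : ℝ) ∧ (q : ℝ) < x},
    {ω | t < D (q : ℝ).toNNReal ω}) ?_ ?_
  · exact (MeasurableSet.biUnion (to_countable _) fun q _ =>
      measurableSet_lt measurable_const (hD.measurable _)).nullMeasurableSet
  · filter_upwards [hD.mono, hD.ae_exists_lt hβ hlam t] with ω hm hne
    refine propext ⟨fun h => ?_, fun h => ?_⟩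
    · obtain ⟨q, hq, hqt⟩ := mem_iUnion₂.1 h
      exact (inverse_le_of_lt hq.1 hqt).trans_lt hq.2
    · obtain ⟨y, hy0, hyx, hyt⟩ := exists_lt_of_inverse_lt hne h
      obtain ⟨q, hyq, hqx⟩ := exists_rat_btwn hyx
      refine mem_iUnion₂.2 ⟨q, ⟨(NNReal.coe_nonneg y).trans_lt hyq, hqx⟩, hyt.trans_le (hm ?_)⟩
      rw [← Real.toNNReal_coe (r := y)]
      exact Real.toNNReal_mono hyq.le

variable [IsProbabilityMeasure P]

lemma potential_apply (hD : IsSubordinator β lam D P) (μ : ℝ) {s : Set ℝ} (hs : MeasurableSet s) :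
    potential D P μ s =
      ∫⁻ x in Ioi 0, ENNReal.ofReal (Real.exp (-μ * x)) * law D P x s := by
  rw [potential, Measure.bind_apply hs hD.measurable_law.aemeasurable, lintegral_expWeight]
  exact (Measure.measurable_coe hs).comp hD.measurable_law

/-- Almost surely {E(t) < x} ⊆ {D(x) > t} ⊆ {E(t) ≤ x}. The transform of the law of E(t) can be
computed from either convention for its distribution function, so the two inclusions give the two
inequalities, and the boundary event {E(t) = x} never has to be examined. -/
lemma ofReal_gCheck (hD : IsSubordinator β lam D P) (hβ : 0 < β) (hlam : 0 ≤ lam) {μ : ℝ}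
    (hμ : 0 < μ) (t : ℝ) : ENNReal.ofReal (gCheck D P μ t) =
      ENNReal.ofReal μ * potential D P μ (Ioi t) := by
  have hE := hD.aemeasurable_inverse hβ hlam t
  have : IsProbabilityMeasure (P.map (inverse D t)) := Measure.isProbabilityMeasure_map hE
  have hν : P.map (inverse D t) (Iio 0) = 0 := by
    rw [Measure.map_apply_of_aemeasurable hE measurableSet_Iio]
    convert measure_empty (μ := P)
    exact eq_empty_of_forall_notMem fun ω hω => not_lt.2 (inverse_nonneg D t ω) hω
  have hL : ENNReal.ofReal (gCheck D P μ t) = measureLaplace (P.map (inverse D t)) μ := by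
    rw [measureLaplace, lintegral_map' (by fun_prop) hE, gCheck,
      ofReal_integral_eq_lintegral_ofReal _ (ae_of_all _ fun _ => (Real.exp_pos _).le)]
    refine Integrable.of_bound (C := 1)
      ((by fun_prop : Measurable fun y => Real.exp (-μ * y)).comp_aemeasurable hE).aestronglyMeasurable
      (ae_of_all _ fun ω => ?_)
    rw [Real.norm_of_nonneg (Real.exp_pos _).le, Real.exp_le_one_iff]
    have := mul_nonneg hμ.le (inverse_nonneg D t ω)
    linarith
  rw [hL, hD.potential_apply μ measurableSet_Ioi]
  refine le_antisymm ?_ ?_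
  · rw [measureLaplace_eq_mul_lintegral_Iio hν hμ]
    refine mul_le_mul' le_rfl (lintegral_mono fun x => mul_le_mul' le_rfl ?_)
    rw [Measure.map_apply_of_aemeasurable hE measurableSet_Iio, law,
      Measure.map_apply (hD.measurable _) measurableSet_Ioi]
    refine measure_mono_ae ?_
    filter_upwards [hD.mono, hD.ae_exists_lt hβ hlam t] with ω hm hne hω
    obtain ⟨y, hy0, hyx, hyt⟩ := exists_lt_of_inverse_lt hne hω
    refine hyt.trans_le (hm ?_)
    rw [← Real.toNNReal_coe (r := y)]
    exact Real.toNNReal_mono hyx.le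
  · rw [measureLaplace_eq_mul_lintegral_Iic hν hμ]
    refine mul_le_mul' le_rfl (setLIntegral_mono' measurableSet_Ioi fun x hx =>
      mul_le_mul' le_rfl ?_)
    rw [Measure.map_apply_of_aemeasurable hE measurableSet_Iic, law,
      Measure.map_apply (hD.measurable _) measurableSet_Ioi]
    exact measure_mono fun ω hω => inverse_le_of_lt hx hω

lemma gCheck_eq (hD : IsSubordinator β lam D P) (hβ : 0 < β) (hlam : 0 ≤ lam) {μ : ℝ}
    (hμ : 0 < μ) (t : ℝ) : gCheck D P μ t = 1 - μ * (potential D P μ).real (Iic t) := by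
  have := hD.isFiniteMeasure_potential hμ
  have h0 : 0 ≤ gCheck D P μ t := integral_nonneg fun _ => (Real.exp_pos _).le
  have h1 := congrArg ENNReal.toReal (hD.ofReal_gCheck hβ hlam hμ t)
  rw [ENNReal.toReal_ofReal h0, ENNReal.toReal_mul, ENNReal.toReal_ofReal hμ.le] at h1
  have h2 := hD.measureLaplace_potential (μ := μ) le_rfl (by rwa [symbol_zero, add_zero])
  simp only [measureLaplace, neg_zero, zero_mul, Real.exp_zero, ENNReal.ofReal_one,
    lintegral_const, one_mul, symbol_zero, add_zero] at h2
  have h3 : (potential D P μ).real univ = 1 / μ := by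
    rw [measureReal_def, h2, ENNReal.toReal_ofReal (by positivity)]
  have h4 := measureReal_compl (μ := potential D P μ) (measurableSet_Iic (a := t))
  rw [compl_Iic, h3] at h4
  rw [h1, ← measureReal_def, h4]
  field_simp

lemma gCheck_nonneg (D : ℝ≥0 → Ω → ℝ) (P : Measure Ω) (μ t : ℝ) : 0 ≤ gCheck D P μ t :=
  integral_nonneg fun _ => (Real.exp_pos _).le

lemma gCheck_le_one (hD : IsSubordinator β lam D P) (hβ : 0 < β) (hlam : 0 ≤ lam) {μ : ℝ}
    (hμ : 0 < μ) (t : ℝ) : gCheck D P μ t ≤ 1 := by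
  rw [hD.gCheck_eq hβ hlam hμ]
  have : 0 ≤ μ * (potential D P μ).real (Iic t) := by positivity
  linarith

lemma gCheck_zero (hD : IsSubordinator β lam D P) (hβ : 0 < β) (hβ1 : β < 1) (hlam : 0 ≤ lam)
    {μ : ℝ} (hμ : 0 < μ) : gCheck D P μ 0 = 1 := by
  rw [hD.gCheck_eq hβ hlam hμ, measureReal_def, hD.potential_Iic_zero hβ hβ1 hlam]
  simp

lemma potential_singleton (hD : IsSubordinator β lam D P) (hβ : 0 < β) (hβ1 : β < 1)
    (hlam : 0 ≤ lam) (μ t : ℝ) : potential D P μ {t} = 0 :=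
  hD.potential_absolutelyContinuous hβ hβ1 hlam μ (measure_singleton _)

end IsSubordinator

/-! ### Continuity and Laplace transform of E[e^{-μE(t)}] -/

/-- The convolution of a finite measure without atoms with a bounded function that is continuous
off the origin is continuous. -/
lemma continuous_integral_sub {n : Measure ℝ} [IsFiniteMeasure n] (hn : ∀ t, n {t} = 0)
    {f : ℝ → ℝ} (hf : ∀ t, t ≠ 0 → ContinuousAt f t) (hm : Measurable f) {M : ℝ}
    (hM : ∀ t, |f t| ≤ M) : Continuous fun t => ∫ y, f (t - y) ∂n := by
  refine continuous_iff_continuousAt.2 fun t => ?_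
  refine continuousAt_of_dominated (bound := fun _ => M)
    (Eventually.of_forall fun x => (by fun_prop : Measurable fun y => f (x - y)).aestronglyMeasurable)
    (Eventually.of_forall fun x => ae_of_all _ fun y => hM _) (integrable_const _) ?_
  have : ∀ᵐ y ∂n, y ≠ t := by
    rw [ae_iff]; simpa using hn t
  filter_upwards [this] with y hy
  exact ContinuousAt.comp (f := fun x => x - y) (x := t) (hf _ (sub_ne_zero.2 hy.symm))
    (by fun_prop)

namespace IsSubordinator

variable {Ω : Type*} [MeasurableSpace Ω] {P : Measure Ω} [IsProbabilityMeasure P]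
  {β lam : ℝ} {D : ℝ≥0 → Ω → ℝ}

lemma continuous_gCheck (hD : IsSubordinator β lam D P) (hβ : 0 < β) (hβ1 : β < 1) (hlam : 0 ≤ lam)
    {μ : ℝ} (hμ : 0 < μ) : Continuous (gCheck D P μ) := by
  have := hD.isFiniteMeasure_potential hμ
  have hc := continuous_integral_sub (n := potential D P μ)
    (hD.potential_singleton hβ hβ1 hlam μ) (f := (Ici 0).indicator 1)
    (fun t ht => ?_) (measurable_one.indicator measurableSet_Ici) (M := 1) fun t => ?_
  · have : gCheck D P μ = fun t =>
        1 - μ * ∫ y, (Ici (0 : ℝ)).indicator (1 : ℝ → ℝ) (t - y) ∂potential D P μ := by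
      ext t
      rw [hD.gCheck_eq hβ hlam hμ, ← integral_indicator_one measurableSet_Iic]
      congr with y
      simp [indicator]
    rw [this]
    fun_prop
  · rcases lt_or_gt_of_ne ht with h | h
    · refine (continuousAt_const (y := (0 : ℝ))).congr ?_
      filter_upwards [Iio_mem_nhds h] with x hx
      rw [indicator_of_notMem (notMem_Ici.2 hx)]
    · refine (continuousAt_const (y := (1 : ℝ))).congr ?_
      filter_upwards [Ioi_mem_nhds h] with x hx
      rw [indicator_of_mem (mem_Ici.2 (le_of_lt hx)), Pi.one_apply]
  · by_cases h : t ∈ Ici (0 : ℝ) <;> simp [h]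

/-- The Laplace transform of `gCheck`. -/
lemma measureLaplace_gCheck (hD : IsSubordinator β lam D P) (hβ : 0 < β) (hβ1 : β < 1)
    (hlam : 0 ≤ lam) {μ : ℝ} (hμ : 0 < μ) {s : ℝ} (hs : 0 < s) :
    measureLaplace (dens (gCheck D P μ)) s =
      ENNReal.ofReal (symbol β lam s / (s * (μ + symbol β lam s))) := by
  have := hD.isFiniteMeasure_potential hμ
  have hψ := symbol_pos hβ hlam hs
  have hν : potential D P μ (Iio 0) = 0 :=
    measure_mono_null Iio_subset_Iic_self (hD.potential_Iic_zero hβ hβ1 hlam μ)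
  have h1 := measureLaplace_eq_mul_lintegral_Iic hν hs
  rw [hD.measureLaplace_potential hs.le (by positivity)] at h1
  have h2 := lintegral_exp_neg_mul_Ioi hs 0
  -- The relation u + μ U((-∞, x]) = 1 is transformed with both terms on one side, so that
  -- subtraction in `ℝ≥0∞` occurs only at the end, between finite quantities.
  have hsum : measureLaplace (dens (gCheck D P μ)) s + ENNReal.ofReal μ *
      ∫⁻ x in Ioi 0, ENNReal.ofReal (Real.exp (-s * x)) * potential D P μ (Iic x) =
      ENNReal.ofReal (1 / s) := by
    rw [mul_zero, Real.exp_zero] at h2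
    have hmeas : Measurable fun x => potential D P μ (Iic x) :=
      Monotone.measurable fun x y hxy => measure_mono (Iic_subset_Iic.2 hxy)
    rw [measureLaplace_dens (hD.continuous_gCheck hβ hβ1 hlam hμ).continuousOn, ← h2,
      ← lintegral_const_mul' _ _ ENNReal.ofReal_ne_top, ← lintegral_add_left]
    · refine lintegral_congr fun x => ?_
      have h0 := gCheck_nonneg D P μ x
      rw [← ofReal_measureReal, ← ENNReal.ofReal_mul (Real.exp_pos _).le,
        ← ENNReal.ofReal_mul hμ.le, ← ENNReal.ofReal_add (by positivity) (by positivity)]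
      congr 1
      rw [hD.gCheck_eq hβ hlam hμ]
      ring
    · have := (hD.continuous_gCheck hβ hβ1 hlam hμ).measurable
      fun_prop
  have hs' : ENNReal.ofReal s ≠ 0 := by simpa using hs
  have h3 := (ENNReal.eq_div_iff hs' ENNReal.ofReal_ne_top).2 h1.symm
  rw [← ENNReal.ofReal_div_of_pos hs] at h3
  rw [h3, ← ENNReal.ofReal_mul hμ.le] at hsum
  rw [ENNReal.eq_sub_of_add_eq ENNReal.ofReal_ne_top hsum, ← ENNReal.ofReal_sub _ (by positivity)]
  congr 1
  field_simp
  ring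

end IsSubordinator

/-! ### The convolution of the Lévy tail with the Gamma kernel -/

instance sFinite_dens (f : ℝ → ℝ) : SFinite (dens f) := by
  unfold dens
  infer_instance

lemma lintegral_halfLine_sub_dens_eq_halfLine {a b : ℝ → ℝ} (ha : ContinuousOn a (Ioi 0))
    (hb : ContinuousOn b (Ioi 0)) (ha0 : ∀ r, 0 < r → 0 ≤ a r) (hb0 : ∀ r, 0 < r → 0 ≤ b r)
    (hint : ∀ t, 0 < t → IntegrableOn (fun y => a (t - y) * b y) (Ioo 0 t)) (t : ℝ) :
    ∫⁻ y, halfLine a (t - y) ∂dens b = halfLine (halfConv a b) t := by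
  rcases le_or_gt t 0 with ht | ht
  · rw [halfLine_of_nonpos ht, lintegral_halfLine_sub_dens ha hb ha0, Ioo_eq_empty (not_lt.2 ht)]
    simp
  · rw [halfLine_of_pos ht,
      lintegral_halfLine_sub_dens_eq_ofReal ha hb ha0 hb0 ht (hint t ht)]

/-- The convolution of two measures with densities on `(0, ∞)`. -/
lemma dens_conv_dens {a b : ℝ → ℝ} (ha : ContinuousOn a (Ioi 0))
    (hb : ContinuousOn b (Ioi 0)) (ha0 : ∀ r, 0 < r → 0 ≤ a r) (hb0 : ∀ r, 0 < r → 0 ≤ b r)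
    (hint : ∀ t, 0 < t → IntegrableOn (fun y => a (t - y) * b y) (Ioo 0 t)) :
    dens a ∗ dens b = dens (halfConv a b) := by
  have h : dens a ∗ dens b =
      volume.withDensity fun t => ∫⁻ y, halfLine a (t - y) ∂dens b :=
    withDensity_conv (measurable_halfLine ha) _
  rw [h]
  unfold dens
  congr with t
  exact lintegral_halfLine_sub_dens_eq_halfLine ha hb ha0 hb0 hint t

lemma halfConv_nonneg {a b : ℝ → ℝ} (ha0 : ∀ r, 0 < r → 0 ≤ a r) (hb0 : ∀ r, 0 < r → 0 ≤ b r)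
    {t : ℝ} (ht : 0 < t) : 0 ≤ halfConv a b t := by
  rw [halfConv, intervalIntegral.integral_of_le ht.le, integral_Ioc_eq_integral_Ioo]
  exact setIntegral_nonneg measurableSet_Ioo fun y hy =>
    mul_nonneg (ha0 _ (sub_pos.2 hy.2)) (hb0 _ hy.1)

section Bounds

variable {β lam : ℝ}

lemma abs_levyTail_le (hβ : 0 < β) (hβ1 : β < 1) (hlam : 0 ≤ lam) {r : ℝ} (hr : 0 < r) :
    |levyTail β lam r| ≤ 1 / Real.Gamma (1 - β) * r ^ (-β) := by
  rw [abs_of_nonneg (levyTail_nonneg hβ hβ1 hr), one_div, ← div_eq_inv_mul]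
  exact levyTail_le hβ hβ1 hlam hr

lemma abs_gammaKernel_le {a : ℝ} (ha : 0 < a) (hlam : 0 ≤ lam) {r : ℝ} (hr : 0 < r) :
    |gammaKernel a lam r| ≤ 1 / Real.Gamma a * r ^ (a - 1) := by
  rw [abs_of_nonneg (gammaKernel_nonneg ha hr), one_div, ← div_eq_inv_mul]
  exact gammaKernel_le ha hlam hr

lemma integrableOn_levyTail_gammaKernel (hβ : 0 < β) (hβ1 : β < 1) (hlam : 0 ≤ lam) {t : ℝ}
    (ht : 0 < t) :
    IntegrableOn (fun y => levyTail β lam (t - y) * gammaKernel β lam y) (Ioo 0 t) :=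
  integrableOn_halfConv (T := t) (by linarith) (by linarith) (continuousOn_levyTail hβ hlam)
    (continuousOn_gammaKernel β lam) (fun _ hr => abs_levyTail_le hβ hβ1 hlam hr.1)
    (fun _ hr => abs_gammaKernel_le hβ hlam hr.1) ⟨ht, le_rfl⟩

lemma continuousOn_halfConv_levyTail_gammaKernel (hβ : 0 < β) (hβ1 : β < 1) (hlam : 0 ≤ lam) :
    ContinuousOn (halfConv (levyTail β lam) (gammaKernel β lam)) (Ioi 0) := by
  intro t ht
  have ht0 : 0 < t := ht
  have := continuousOn_halfConv (T := t + 1) (by linarith) (by linarith)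
    (continuousOn_levyTail hβ hlam) (continuousOn_gammaKernel β lam)
    (fun _ hr => abs_levyTail_le hβ hβ1 hlam hr.1) (fun _ hr => abs_gammaKernel_le hβ hlam hr.1)
  exact (this.continuousAt (Ioo_mem_nhds ht0 (lt_add_one t))).continuousWithinAt

/-- The singularities r^{-β} and r^{β-1} are complementary: the exponent of t in the convolution
bound is -β + (β - 1) + 1 = 0, so the bound is uniform on (0, ∞). -/
lemma exists_halfConv_levyTail_gammaKernel_le (hβ : 0 < β) (hβ1 : β < 1) (hlam : 0 ≤ lam) :
    ∃ M, 0 ≤ M ∧ ∀ t, 0 < t → |halfConv (levyTail β lam) (gammaKernel β lam) t| ≤ M := by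
  have h : ∀ t, 0 < t → |halfConv (levyTail β lam) (gammaKernel β lam) t| ≤ _ := fun t ht =>
    abs_halfConv_le (T := t) (p := -β) (q := β - 1) (by linarith) (by linarith)
      (fun _ hr => abs_levyTail_le hβ hβ1 hlam hr.1)
      (fun _ hr => abs_gammaKernel_le hβ hlam hr.1) ⟨ht, le_rfl⟩
  simp only [show -β + (β - 1) + 1 = 0 by ring, Real.rpow_zero] at h
  exact ⟨_, (abs_nonneg _).trans (h 1 one_pos), h⟩

end Bounds

/-! ### The inverse density and the identity φ * U = E[e^{-μE(t)}] at every positive time -/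

lemma inverseDensity_nonneg {Ω : Type*} [MeasurableSpace Ω] {D : ℝ≥0 → Ω → ℝ} {P : Measure Ω}
    {β lam : ℝ} (hβ : 0 < β) (hβ1 : β < 1) {t : ℝ} (ht : 0 < t) (x : ℝ) :
    0 ≤ inverseDensity β lam D P t x :=
  halfConv_nonneg (b := fun y => density D P y x) (fun _ hr => levyTail_nonneg hβ hβ1 hr)
    (fun _ _ => ENNReal.toReal_nonneg) ht

namespace IsSubordinator

variable {Ω : Type*} [MeasurableSpace Ω] {P : Measure Ω} [IsProbabilityMeasure P]
  {β lam : ℝ} {D : ℝ≥0 → Ω → ℝ}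

/-- On (0, t) the density is at most C e^t almost everywhere, and the singularity (t - y)^{-β} of
the tail is integrable. -/
lemma integrableOn_levyTail_mul_density (hD : IsSubordinator β lam D P) (hβ : 0 < β) (hβ1 : β < 1)
    (hlam : 0 ≤ lam) {t x : ℝ} (ht : 0 < t) (hx : 0 < x) :
    IntegrableOn (fun y => levyTail β lam (t - y) * density D P y x) (Ioo 0 t) := by
  obtain ⟨-, C, hC⟩ := hD.law_absolutelyContinuous hβ hβ1 hlam hx
  refine integrableOn_halfConv_of_bounded (p := -β) (C := C * Real.exp t) (by linarith) ht
    (continuousOn_levyTail hβ hlam) (fun r hr => abs_levyTail_le hβ hβ1 hlam hr)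
    (measurable_pdf _ _ _).ennreal_toReal.aestronglyMeasurable ?_
  filter_upwards [ae_restrict_of_ae hC, ae_restrict_mem measurableSet_Ioo] with y hy hyt
  rw [density, abs_of_nonneg ENNReal.toReal_nonneg, pdf_def]
  refine ENNReal.toReal_le_of_le_ofReal (by positivity) (hy.trans ?_)
  rw [ENNReal.ofReal_mul C.coe_nonneg, ENNReal.ofReal_coe_nnreal]
  gcongr
  exact hyt.2.le

lemma ofReal_inverseDensity (hD : IsSubordinator β lam D P) (hβ : 0 < β) (hβ1 : β < 1)
    (hlam : 0 ≤ lam) {t x : ℝ} (ht : 0 < t) (hx : 0 < x) :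
    ENNReal.ofReal (inverseDensity β lam D P t x) =
      ∫⁻ y, halfLine (levyTail β lam) (t - y) ∂law D P x := by
  have hφ := measurable_halfLine (continuousOn_levyTail hβ hlam (lam := lam))
  have hac := (hD.law_absolutelyContinuous hβ hβ1 hlam hx).1
  have := hD.isProbabilityMeasure_law x
  have hpos : ∀ᵐ y ∂law D P x, 0 < y := by
    rw [ae_iff]
    simp only [not_lt]
    change law D P x (Iic 0) = 0
    rw [← Iio_union_right]
    exact measure_union_null (hD.law_Iio_zero x) (hac (measure_singleton _))
  have h1 : ∫⁻ y, halfLine (levyTail β lam) (t - y) ∂law D P x =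
      ∫⁻ y, (Ioi 0).indicator (fun y => halfLine (levyTail β lam) (t - y)) y ∂law D P x := by
    refine lintegral_congr_ae ?_
    filter_upwards [hpos] with y hy
    rw [indicator_of_mem (mem_Ioi.2 hy)]
  rw [h1, ← lintegral_rnDeriv_mul hac
    ((by fun_prop : Measurable fun y => halfLine (levyTail β lam) (t - y)).indicator
      measurableSet_Ioi).aemeasurable, inverseDensity, intervalIntegral.integral_of_le ht.le,
    integral_Ioc_eq_integral_Ioo, ofReal_integral_eq_lintegral_ofReal
      (hD.integrableOn_levyTail_mul_density hβ hβ1 hlam ht hx),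
    ← lintegral_indicator measurableSet_Ioo]
  · refine lintegral_congr_ae ?_
    filter_upwards [Measure.rnDeriv_lt_top (law D P x) volume] with y hy
    by_cases hyt : y ∈ Ioo 0 t
    · have hty : 0 < t - y := sub_pos.2 hyt.2
      rw [indicator_of_mem hyt, indicator_of_mem (mem_Ioi.2 hyt.1), halfLine_of_pos hty,
        ENNReal.ofReal_mul (levyTail_nonneg hβ hβ1 hty), density, pdf_def, mul_comm]
      congr 1
      exact ENNReal.ofReal_toReal hy.ne
    · rw [indicator_of_notMem hyt]
      rcases le_or_gt y 0 with h | h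
      · rw [indicator_of_notMem (notMem_Ioi.2 h), mul_zero]
      · rw [indicator_of_mem (mem_Ioi.2 h), halfLine_of_nonpos (t := t - y), mul_zero]
        exact sub_nonpos.2 (not_lt.1 fun h' => hyt ⟨h, h'⟩)
  · filter_upwards [ae_restrict_mem measurableSet_Ioo] with y hy
    exact mul_nonneg (levyTail_nonneg hβ hβ1 (sub_pos.2 hy.2)) ENNReal.toReal_nonneg

/-- The resolvent identity between the potential measure and the Gamma kernel, with all terms
moved to the side where they are nonnegative. -/
lemma potential_resolvent (hD : IsSubordinator β lam D P) (hβ : 0 < β) (hlam : 0 ≤ lam) {μ : ℝ}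
    (hμ : 0 < μ) :
    potential D P μ + (μ - lam ^ β).toNNReal • (potential D P μ ∗ dens (gammaKernel β lam)) =
      dens (gammaKernel β lam) +
        (lam ^ β - μ).toNNReal • (potential D P μ ∗ dens (gammaKernel β lam)) := by
  have := hD.isFiniteMeasure_potential hμ
  have hU : ∀ s, 0 < s →
      measureLaplace (potential D P μ) s = ENNReal.ofReal (1 / (μ + symbol β lam s)) :=
    fun s hs => hD.measureLaplace_potential hs.le (add_pos hμ (symbol_pos hβ hlam hs))
  have hV : ∀ s, 0 < s → measureLaplace (dens (gammaKernel β lam)) s =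
      ENNReal.ofReal ((s + lam) ^ (-β)) :=
    fun s hs => measureLaplace_gammaKernel hβ (by linarith)
  have hside : ∀ s, 0 < s → ∀ (c : ℝ≥0) (m : Measure ℝ) (a : ℝ), 0 ≤ a →
      measureLaplace m s = ENNReal.ofReal a →
      measureLaplace (m + c • (potential D P μ ∗ dens (gammaKernel β lam))) s =
        ENNReal.ofReal (a + c * (1 / (μ + symbol β lam s) * (s + lam) ^ (-β))) := by
    intro s hs c m a ha hm
    have h1 := symbol_pos hβ hlam hs
    have h2 : 0 < s + lam := by linarith
    rw [measureLaplace_add, measureLaplace_smul, measureLaplace_conv, hm, hU s hs, hV s hs,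
      ENNReal.ofReal_add ha (by positivity), ENNReal.ofReal_mul c.coe_nonneg,
      ENNReal.ofReal_mul (by positivity), ENNReal.ofReal_coe_nnreal]
  refine ext_of_measureLaplace (fun s hs => ?_) fun s hs => ?_
  · have h1 := symbol_pos hβ hlam hs
    rw [hside s hs _ _ _ (by positivity) (hU s hs)]
    exact ENNReal.ofReal_ne_top
  · have h1 := symbol_pos hβ hlam hs
    have h2 : 0 < s + lam := by linarith
    rw [hside s hs _ _ _ (by positivity) (hU s hs), hside s hs _ _ _ (by positivity) (hV s hs)]
    congr 1
    -- The signed coefficient λ^β - μ was split into its two parts. Recombined, the identity to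
    -- check is 1/(μ + ψ) = (s + λ)^{-β} (1 + (λ^β - μ)/(μ + ψ)), which holds as μ + ψ + λ^β - μ =
    -- (s + λ)^β.
    have h3 : ((μ - lam ^ β).toNNReal : ℝ) = ((lam ^ β - μ).toNNReal : ℝ) + (μ - lam ^ β) := by
      rw [Real.coe_toNNReal', Real.coe_toNNReal', ← neg_sub μ]
      have := max_zero_sub_max_neg_zero_eq_self (μ - lam ^ β)
      linarith
    have h4 : symbol β lam s = (s + lam) ^ β - lam ^ β := rfl
    have h5 : (s + lam) ^ (-β) * (s + lam) ^ β = 1 := by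
      rw [← Real.rpow_add h2, neg_add_cancel, Real.rpow_zero]
    have h6 : (s + lam) ^ β = symbol β lam s + lam ^ β := by rw [h4]; ring
    rw [h6] at h5
    rw [h3]
    have h7 : 0 < μ + symbol β lam s := by positivity
    field_simp
    linear_combination -h5

/-- The function `t ↦ ∫ φ(t - y) U(dy)` in terms of functions that are visibly continuous. -/
lemma lintegral_levyTail_potential (hD : IsSubordinator β lam D P) (hβ : 0 < β) (hβ1 : β < 1)
    (hlam : 0 ≤ lam) {μ : ℝ} (hμ : 0 < μ) {t : ℝ} (ht : 0 < t) :
    (∫⁻ y, halfLine (levyTail β lam) (t - y) ∂potential D P μ) ≠ ∞ ∧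
    (∫⁻ y, halfLine (levyTail β lam) (t - y) ∂potential D P μ).toReal =
      halfConv (levyTail β lam) (gammaKernel β lam) t + (lam ^ β - μ) *
        ∫ z, (halfLine (halfConv (levyTail β lam) (gammaKernel β lam)) (t - z)).toReal
          ∂potential D P μ := by
  have := hD.isFiniteMeasure_potential hμ
  have hφc := continuousOn_levyTail hβ hlam (lam := lam)
  have hφ := measurable_halfLine hφc
  have hh := measurable_halfLine (continuousOn_halfConv_levyTail_gammaKernel hβ hβ1 hlam)
  have hV : ∀ t, ∫⁻ y, halfLine (levyTail β lam) (t - y) ∂dens (gammaKernel β lam) =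
      halfLine (halfConv (levyTail β lam) (gammaKernel β lam)) t :=
    lintegral_halfLine_sub_dens_eq_halfLine hφc (continuousOn_gammaKernel β lam)
      (fun _ hr => levyTail_nonneg hβ hβ1 hr) (fun _ hr => gammaKernel_nonneg hβ hr)
      fun t ht => integrableOn_levyTail_gammaKernel hβ hβ1 hlam ht
  set h := halfConv (levyTail β lam) (gammaKernel β lam) with hh_def
  obtain ⟨M, hM0, hM⟩ := exists_halfConv_levyTail_gammaKernel_le hβ hβ1 hlam
  have hconv : ∫⁻ y, halfLine (levyTail β lam) (t - y)
      ∂(potential D P μ ∗ dens (gammaKernel β lam)) =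
      ∫⁻ z, halfLine h (t - z) ∂potential D P μ := by
    rw [Measure.lintegral_conv (by fun_prop)]
    refine lintegral_congr fun z => ?_
    simp_rw [← sub_sub]
    exact hV (t - z)
  have hHfin : ∫⁻ z, halfLine h (t - z) ∂potential D P μ ≠ ∞ := by
    refine ne_top_of_le_ne_top (b := ∫⁻ _, ENNReal.ofReal M ∂potential D P μ) ?_
      (lintegral_mono fun z => ?_)
    · rw [lintegral_const]
      exact ENNReal.mul_ne_top ENNReal.ofReal_ne_top (measure_ne_top _ _)
    · rcases le_or_gt (t - z) 0 with hz | hz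
      · rw [halfLine_of_nonpos hz]; exact zero_le
      · rw [halfLine_of_pos hz]
        exact ENNReal.ofReal_le_ofReal ((le_abs_self _).trans (hM _ hz))
  have hH : ∫ z, (halfLine h (t - z)).toReal ∂potential D P μ =
      (∫⁻ z, halfLine h (t - z) ∂potential D P μ).toReal :=
    integral_toReal (by fun_prop : Measurable fun z => halfLine h (t - z)).aemeasurable
      (ae_of_all _ fun z => (halfLine_ne_top _ _).lt_top)
  have key := congrArg (fun m => ∫⁻ y, halfLine (levyTail β lam) (t - y) ∂m)
    (hD.potential_resolvent hβ hlam hμ)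
  simp only [lintegral_add_measure, lintegral_smul_measure, hconv, hV] at key
  have hfin : (∫⁻ y, halfLine (levyTail β lam) (t - y) ∂potential D P μ) ≠ ∞ := by
    refine ne_top_of_le_ne_top ?_ (le_self_add.trans key.le)
    exact ENNReal.add_ne_top.2 ⟨halfLine_ne_top _ _, ENNReal.mul_ne_top ENNReal.coe_ne_top hHfin⟩
  refine ⟨hfin, ?_⟩
  have key' := congrArg ENNReal.toReal key
  simp only [ENNReal.smul_def, smul_eq_mul] at key'
  rw [ENNReal.toReal_add hfin (ENNReal.mul_ne_top ENNReal.coe_ne_top hHfin),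
    ENNReal.toReal_add (halfLine_ne_top _ _) (ENNReal.mul_ne_top ENNReal.coe_ne_top hHfin),
    ENNReal.toReal_mul, ENNReal.toReal_mul, ENNReal.coe_toReal, ENNReal.coe_toReal,
    halfLine_of_pos ht, ENNReal.toReal_ofReal (halfConv_nonneg
      (fun _ hr => levyTail_nonneg hβ hβ1 hr) (fun _ hr => gammaKernel_nonneg hβ hr) ht),
    Real.coe_toNNReal', Real.coe_toNNReal', ← neg_sub μ] at key'
  have h3 := max_zero_sub_max_neg_zero_eq_self (μ - lam ^ β)
  rw [hH]
  linear_combination key' - (∫⁻ z, halfLine h (t - z) ∂potential D P μ).toReal * h3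

/-- The identity `∫ φ(t - y) U(dy) = E[e^{-μ E(t)}]` at every `t > 0`. -/
lemma lintegral_levyTail_potential_eq (hD : IsSubordinator β lam D P) (hβ : 0 < β) (hβ1 : β < 1)
    (hlam : 0 ≤ lam) {μ : ℝ} (hμ : 0 < μ) {t : ℝ} (ht : 0 < t) :
    ∫⁻ y, halfLine (levyTail β lam) (t - y) ∂potential D P μ =
      ENNReal.ofReal (gCheck D P μ t) := by
  have := hD.isFiniteMeasure_potential hμ
  have hφ := measurable_halfLine (continuousOn_levyTail hβ hlam (lam := lam))
  have hu := hD.continuous_gCheck hβ hβ1 hlam hμ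
  -- Both transforms equal (ψ/s) · 1/(μ + ψ). Uniqueness gives equality of measures, hence of
  -- densities almost everywhere only.
  have hmeas : dens (levyTail β lam) ∗ potential D P μ = dens (gCheck D P μ) := by
    have hL : ∀ s, 0 < s → measureLaplace (dens (levyTail β lam) ∗ potential D P μ) s =
        ENNReal.ofReal (symbol β lam s / (s * (μ + symbol β lam s))) := by
      intro s hs
      have h1 := symbol_pos hβ hlam hs
      rw [measureLaplace_conv, measureLaplace_levyTail hβ hβ1 hlam hs,
        hD.measureLaplace_potential hs.le (by positivity), ← ENNReal.ofReal_mul (by positivity)]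
      congr 1
      field_simp
    refine ext_of_measureLaplace (fun s hs => ?_) fun s hs => ?_
    · rw [hL s hs]; exact ENNReal.ofReal_ne_top
    · rw [hL s hs, hD.measureLaplace_gCheck hβ hβ1 hlam hμ hs]
  have hae : (fun t => ∫⁻ y, halfLine (levyTail β lam) (t - y) ∂potential D P μ) =ᵐ[volume]
      halfLine (gCheck D P μ) := by
    have h : dens (levyTail β lam) ∗ potential D P μ = volume.withDensity
        fun t => ∫⁻ y, halfLine (levyTail β lam) (t - y) ∂potential D P μ :=
      withDensity_conv hφ _
    rw [h, dens] at hmeas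
    refine (withDensity_eq_iff_of_sigmaFinite ?_ ?_).1 hmeas
    · exact (Measurable.lintegral_prod_right'
        (f := fun p : ℝ × ℝ => halfLine (levyTail β lam) (p.1 - p.2)) (by fun_prop)).aemeasurable
    · exact (measurable_halfLine hu.continuousOn).aemeasurable
  set A := fun t => (∫⁻ y, halfLine (levyTail β lam) (t - y) ∂potential D P μ).toReal with hA
  -- Continuity is read off the resolvent form: the bounded function φ * V jumps only at the origin,
  -- and the potential has no atoms. With it the almost everywhere equality becomes equality at each
  -- t > 0.
  have hAc : ContinuousOn A (Ioi 0) := by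
    obtain ⟨M, hM0, hM⟩ := exists_halfConv_levyTail_gammaKernel_le hβ hβ1 hlam
    have hhc := continuousOn_halfConv_levyTail_gammaKernel hβ hβ1 hlam
    have hh := measurable_halfLine hhc
    refine ContinuousOn.congr ?_ fun t ht =>
      (hD.lintegral_levyTail_potential hβ hβ1 hlam hμ ht).2
    refine hhc.add (Continuous.continuousOn (continuous_const.mul ?_))
    refine continuous_integral_sub (hD.potential_singleton hβ hβ1 hlam μ)
      (f := fun t => (halfLine (halfConv (levyTail β lam) (gammaKernel β lam)) t).toReal)
      (fun t ht => ?_) hh.ennreal_toReal (M := M) fun t => ?_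
    · rcases lt_or_gt_of_ne ht with h | h
      · refine (continuousAt_const (y := (0 : ℝ))).congr ?_
        filter_upwards [Iio_mem_nhds h] with x hx
        rw [halfLine_of_nonpos (le_of_lt hx), ENNReal.toReal_zero]
      · refine (hhc.continuousAt (Ioi_mem_nhds h)).congr ?_
        filter_upwards [Ioi_mem_nhds h] with x hx
        rw [halfLine_of_pos hx, ENNReal.toReal_ofReal (halfConv_nonneg
          (fun _ hr => levyTail_nonneg hβ hβ1 hr) (fun _ hr => gammaKernel_nonneg hβ hr) hx)]
    · rcases le_or_gt t 0 with h | h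
      · simp [halfLine_of_nonpos h, hM0]
      · rw [halfLine_of_pos h, ENNReal.toReal_ofReal (halfConv_nonneg
          (fun _ hr => levyTail_nonneg hβ hβ1 hr) (fun _ hr => gammaKernel_nonneg hβ hr) h)]
        exact hM t h
  have hEq : EqOn A (gCheck D P μ) (Ioi 0) := by
    refine Measure.eqOn_open_of_ae_eq (μ := volume) ?_ isOpen_Ioi hAc hu.continuousOn
    filter_upwards [ae_restrict_of_ae hae, ae_restrict_mem measurableSet_Ioi] with r hr hr0
    rw [hA]
    simp only
    rw [hr, halfLine_of_pos hr0, ENNReal.toReal_ofReal (gCheck_nonneg D P μ r)]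
  rw [← hEq ht, hA]
  exact (ENNReal.ofReal_toReal (hD.lintegral_levyTail_potential hβ hβ1 hlam hμ ht).1).symm

lemma lintegral_inverseDensity (hD : IsSubordinator β lam D P) (hβ : 0 < β) (hβ1 : β < 1)
    (hlam : 0 ≤ lam) {μ : ℝ} (hμ : 0 < μ) {t : ℝ} (ht : 0 < t) :
    ∫⁻ x in Ioi 0, ENNReal.ofReal (Real.exp (-μ * x) * inverseDensity β lam D P t x) =
      ENNReal.ofReal (gCheck D P μ t) := by
  have hφ := measurable_halfLine (continuousOn_levyTail hβ hlam (lam := lam))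
  rw [← hD.lintegral_levyTail_potential_eq hβ hβ1 hlam hμ ht,
    hD.lintegral_potential μ (by fun_prop)]
  refine setLIntegral_congr_fun measurableSet_Ioi fun x hx => ?_
  rw [ENNReal.ofReal_mul (Real.exp_pos _).le, hD.ofReal_inverseDensity hβ hβ1 hlam ht hx]

lemma integrableOn_exp_mul_inverseDensity (hD : IsSubordinator β lam D P) (hβ : 0 < β)
    (hβ1 : β < 1) (hlam : 0 ≤ lam) {μ : ℝ} (hμ : 0 < μ) {t : ℝ} (ht : 0 < t) :
    IntegrableOn (fun x => Real.exp (-μ * x) * inverseDensity β lam D P t x) (Ioi 0) := by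
  have hφ := measurable_halfLine (continuousOn_levyTail hβ hlam (lam := lam))
  have hm : Measurable fun x =>
      (∫⁻ y, halfLine (levyTail β lam) (t - y) ∂law D P x).toReal :=
    ((Measure.measurable_lintegral (by fun_prop)).comp hD.measurable_law).ennreal_toReal
  refine ⟨AEStronglyMeasurable.congr (f := fun x => Real.exp (-μ * x) *
    (∫⁻ y, halfLine (levyTail β lam) (t - y) ∂law D P x).toReal)
    (by fun_prop : Measurable _).aestronglyMeasurable ?_, ?_⟩
  · filter_upwards [ae_restrict_mem measurableSet_Ioi] with x hx
    rw [← hD.ofReal_inverseDensity hβ hβ1 hlam ht hx,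
      ENNReal.toReal_ofReal (inverseDensity_nonneg hβ hβ1 ht x)]
  · rw [hasFiniteIntegral_iff_ofReal (ae_of_all _ fun x =>
      mul_nonneg (Real.exp_pos _).le (inverseDensity_nonneg hβ hβ1 ht x)),
      hD.lintegral_inverseDensity hβ hβ1 hlam hμ ht]
    exact ENNReal.ofReal_lt_top

lemma integral_exp_mul_inverseDensity (hD : IsSubordinator β lam D P) (hβ : 0 < β)
    (hβ1 : β < 1) (hlam : 0 ≤ lam) {μ : ℝ} (hμ : 0 < μ) {t : ℝ} (ht : 0 < t) :
    ∫ x in Ioi (0 : ℝ), Real.exp (-μ * x) * inverseDensity β lam D P t x = gCheck D P μ t := by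
  rw [integral_eq_lintegral_of_nonneg_ae (ae_of_all _ fun x =>
      mul_nonneg (Real.exp_pos _).le (inverseDensity_nonneg hβ hβ1 ht x))
    (hD.integrableOn_exp_mul_inverseDensity hβ hβ1 hlam hμ ht).1,
    hD.lintegral_inverseDensity hβ hβ1 hlam hμ ht, ENNReal.toReal_ofReal (gCheck_nonneg D P μ t)]

end IsSubordinator

/-! ### The tempered fractional equation -/

lemma measureLaplace_exp {lam s : ℝ} (hs : 0 < s + lam) :
    measureLaplace (dens fun r => Real.exp (-lam * r)) s = ENNReal.ofReal (1 / (s + lam)) := by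
  have h := lintegral_exp_neg_mul_Ioi hs 0
  rw [mul_zero, Real.exp_zero] at h
  rw [measureLaplace_dens (continuousOn_exp_neg_mul lam), ← h]
  refine lintegral_congr fun t => ?_
  rw [← Real.exp_add]
  ring_nf

lemma abs_exp_neg_mul_le {lam : ℝ} (hlam : 0 ≤ lam) {r : ℝ} (hr : 0 < r) :
    |Real.exp (-lam * r)| ≤ 1 * r ^ (0 : ℝ) := by
  rw [Real.rpow_zero, one_mul, abs_of_pos (Real.exp_pos _), Real.exp_le_one_iff]
  nlinarith

lemma halfConv_exp (lam : ℝ) (f : ℝ → ℝ) (t : ℝ) :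
    halfConv (fun r => Real.exp (-lam * r)) f t =
      Real.exp (-lam * t) * ∫ r in (0 : ℝ)..t, Real.exp (lam * r) * f r := by
  rw [halfConv, ← intervalIntegral.integral_const_mul]
  congr with r
  rw [← mul_assoc, ← Real.exp_add]
  ring_nf

lemma halfConv_gammaKernel (β lam : ℝ) (f : ℝ → ℝ) {t : ℝ} (ht : 0 < t) :
    halfConv (gammaKernel (1 - β) lam) f t =
      Real.exp (-lam * t) / Real.Gamma (1 - β) * fracIntegral β lam f t := by
  rw [halfConv, fracIntegral, ← intervalIntegral.integral_const_mul,
    intervalIntegral.integral_of_le ht.le, intervalIntegral.integral_of_le ht.le]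
  refine setIntegral_congr_fun measurableSet_Ioc fun r hr => ?_
  have hE : Real.exp (-lam * (t - r)) = Real.exp (-lam * t) * Real.exp (lam * r) := by
    rw [← Real.exp_add]; ring_nf
  simp only [gammaKernel]
  rw [hE, show 1 - β - 1 = -β by ring, Real.rpow_neg (sub_nonneg.2 hr.2)]
  field_simp

lemma continuousOn_Ioi_of_forall_Ioo {f : ℝ → ℝ} (h : ∀ T, ContinuousOn f (Ioo 0 T)) :
    ContinuousOn f (Ioi 0) := fun t ht =>
  ((h (t + 1)).continuousAt (Ioo_mem_nhds ht (lt_add_one t))).continuousWithinAt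

lemma dens_add {f g : ℝ → ℝ} (hf : ContinuousOn f (Ioi 0)) (hf0 : ∀ t, 0 < t → 0 ≤ f t)
    (hg0 : ∀ t, 0 < t → 0 ≤ g t) : dens f + dens g = dens (fun t => f t + g t) := by
  unfold dens
  rw [← withDensity_add_left (measurable_halfLine hf)]
  congr with t
  rw [Pi.add_apply]
  rcases le_or_gt t 0 with h | h
  · simp [halfLine_of_nonpos h]
  · rw [halfLine_of_pos h, halfLine_of_pos h, halfLine_of_pos h,
      ENNReal.ofReal_add (hf0 t h) (hg0 t h)]

lemma smul_dens {f : ℝ → ℝ} (hf : ContinuousOn f (Ioi 0)) (c : ℝ≥0) :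
    c • dens f = dens (fun t => c * f t) := by
  unfold dens
  have := withDensity_smul (μ := volume) (c : ℝ≥0∞) (measurable_halfLine hf)
  refine Eq.trans this.symm ?_
  congr with t
  rw [Pi.smul_apply, smul_eq_mul]
  rcases le_or_gt t 0 with h | h
  · simp [halfLine_of_nonpos h]
  · rw [halfLine_of_pos h, halfLine_of_pos h, ENNReal.ofReal_mul c.coe_nonneg,
      ENNReal.ofReal_coe_nnreal]

/-- Continuous nonnegative densities are determined by their measures. -/
lemma eqOn_of_dens_eq {f g : ℝ → ℝ} (hf : ContinuousOn f (Ioi 0)) (hg : ContinuousOn g (Ioi 0))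
    (hf0 : ∀ t, 0 < t → 0 ≤ f t) (hg0 : ∀ t, 0 < t → 0 ≤ g t) (h : dens f = dens g) :
    EqOn f g (Ioi 0) := by
  refine Measure.eqOn_open_of_ae_eq (μ := volume) ?_ isOpen_Ioi hf hg
  have hae := (withDensity_eq_iff_of_sigmaFinite (measurable_halfLine hf).aemeasurable
    (measurable_halfLine hg).aemeasurable).1 h
  filter_upwards [ae_restrict_of_ae hae, ae_restrict_mem measurableSet_Ioi] with t ht ht0
  rw [halfLine_of_pos ht0, halfLine_of_pos ht0] at ht
  exact (ENNReal.ofReal_eq_ofReal_iff (hf0 t ht0) (hg0 t ht0)).1 ht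

lemma intervalIntegrable_levyTail {β lam : ℝ} (hβ : 0 < β) (hβ1 : β < 1) (hlam : 0 ≤ lam) {t : ℝ}
    (ht : 0 < t) :
    IntervalIntegrable (fun r => Real.exp (lam * r) * levyTail β lam r) volume 0 t := by
  refine IntervalIntegrable.continuousOn_mul ?_ (by fun_prop)
  rw [intervalIntegrable_iff_integrableOn_Ioo_of_le ht.le]
  have h := intervalIntegral.intervalIntegrable_rpow' (a := 0) (b := t) (by linarith : -1 < -β)
  rw [intervalIntegrable_iff_integrableOn_Ioo_of_le ht.le] at h
  refine Integrable.mono' (h.const_mul (1 / Real.Gamma (1 - β)))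
    (((continuousOn_levyTail hβ hlam).mono fun r hr => hr.1).aestronglyMeasurable
      measurableSet_Ioo) ?_
  filter_upwards [ae_restrict_mem measurableSet_Ioo] with r hr
  exact abs_levyTail_le hβ hβ1 hlam hr.1

namespace IsSubordinator

variable {Ω : Type*} [MeasurableSpace Ω] {P : Measure Ω} [IsProbabilityMeasure P]
  {β lam : ℝ} {D : ℝ≥0 → Ω → ℝ}

lemma abs_gCheck_le (hD : IsSubordinator β lam D P) (hβ : 0 < β) (hlam : 0 ≤ lam) {μ : ℝ}
    (hμ : 0 < μ) (t : ℝ) : |gCheck D P μ t| ≤ 1 * t ^ (0 : ℝ) := by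
  rw [Real.rpow_zero, one_mul, abs_of_nonneg (gCheck_nonneg D P μ t)]
  exact hD.gCheck_le_one hβ hlam hμ t

/-- The convolution form of the fractional equation for `gCheck`, before differentiation. -/
lemma halfConv_gammaKernel_gCheck (hD : IsSubordinator β lam D P) (hβ : 0 < β) (hβ1 : β < 1)
    (hlam : 0 ≤ lam) {μ : ℝ} (hμ : 0 < μ) {t : ℝ} (ht : 0 < t) :
    halfConv (gammaKernel (1 - β) lam) (gCheck D P μ) t +
        μ * halfConv (fun r => Real.exp (-lam * r)) (gCheck D P μ) t =
      lam ^ β * halfConv (fun r => Real.exp (-lam * r)) (gCheck D P μ) t +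
        halfConv (fun r => Real.exp (-lam * r)) (levyTail β lam) t := by
  set u := gCheck D P μ with hu_def
  set e : ℝ → ℝ := fun r => Real.exp (-lam * r) with he_def
  set k := gammaKernel (1 - β) lam with hk_def
  set φ := levyTail β lam with hφ_def
  have hβ' : 0 < 1 - β := sub_pos.2 hβ1
  have hlamβ : 0 ≤ lam ^ β := Real.rpow_nonneg hlam _
  have hu : ContinuousOn u (Ioi 0) := (hD.continuous_gCheck hβ hβ1 hlam hμ).continuousOn
  have he : ContinuousOn e (Ioi 0) := continuousOn_exp_neg_mul lam
  have hk : ContinuousOn k (Ioi 0) := continuousOn_gammaKernel _ _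
  have hφ : ContinuousOn φ (Ioi 0) := continuousOn_levyTail hβ hlam
  have hu0 : ∀ r, 0 < r → 0 ≤ u r := fun r _ => gCheck_nonneg D P μ r
  have he0 : ∀ r, 0 < r → 0 ≤ e r := fun r _ => (Real.exp_pos _).le
  have hk0 : ∀ r, 0 < r → 0 ≤ k r := fun r hr => gammaKernel_nonneg hβ' hr
  have hφ0 : ∀ r, 0 < r → 0 ≤ φ r := fun r hr => levyTail_nonneg hβ hβ1 hr
  have bu : ∀ r, 0 < r → |u r| ≤ 1 * r ^ (0 : ℝ) := fun r _ => hD.abs_gCheck_le hβ hlam hμ r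
  have be : ∀ r, 0 < r → |e r| ≤ 1 * r ^ (0 : ℝ) := fun r hr => abs_exp_neg_mul_le hlam hr
  have bk : ∀ r, 0 < r → |k r| ≤ 1 / Real.Gamma (1 - β) * r ^ (1 - β - 1) :=
    fun r hr => abs_gammaKernel_le hβ' hlam hr
  have bφ : ∀ r, 0 < r → |φ r| ≤ 1 / Real.Gamma (1 - β) * r ^ (-β) :=
    fun r hr => abs_levyTail_le hβ hβ1 hlam hr
  have conv_facts : ∀ {a b : ℝ → ℝ} {A B p q : ℝ}, ContinuousOn a (Ioi 0) → ContinuousOn b (Ioi 0) →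
      (∀ r, 0 < r → 0 ≤ a r) → (∀ r, 0 < r → 0 ≤ b r) → -1 < p → -1 < q →
      (∀ r, 0 < r → |a r| ≤ A * r ^ p) → (∀ r, 0 < r → |b r| ≤ B * r ^ q) →
      dens a ∗ dens b = dens (halfConv a b) ∧ ContinuousOn (halfConv a b) (Ioi 0) ∧
      ∀ r, 0 < r → 0 ≤ halfConv a b r := by
    intro a b A B p q ha hb ha0 hb0 hp hq ba bb
    exact ⟨dens_conv_dens ha hb ha0 hb0 fun t ht => integrableOn_halfConv (T := t) hp hq ha hb
      (fun r hr => ba r hr.1) (fun r hr => bb r hr.1) ⟨ht, le_rfl⟩,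
      continuousOn_Ioi_of_forall_Ioo fun T => continuousOn_halfConv hp hq ha hb
        (fun r hr => ba r hr.1) (fun r hr => bb r hr.1),
      fun r hr => halfConv_nonneg ha0 hb0 hr⟩
  obtain ⟨ku, kuc, ku0⟩ := conv_facts hk hu hk0 hu0 (by linarith) (by norm_num) bk bu
  obtain ⟨eu, euc, eu0⟩ := conv_facts he hu he0 hu0 (by norm_num) (by norm_num) be bu
  obtain ⟨ef, efc, ef0⟩ := conv_facts he hφ he0 hφ0 (by norm_num) (by linarith) be bφ
  -- In transforms this is ψũ - ψ/s = -μũ divided by s + λ, with the term in λ^β moved to the right: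
  -- convolution with e^{-λr} is division by s + λ, and the kernel of index 1 - β contributes (s +
  -- λ)^{β-1}.
  have hmeas : dens k ∗ dens u + μ.toNNReal • (dens e ∗ dens u) =
      (lam ^ β).toNNReal • (dens e ∗ dens u) + dens e ∗ dens φ := by
    have hLu : ∀ s, 0 < s → measureLaplace (dens u) s =
        ENNReal.ofReal (symbol β lam s / (s * (μ + symbol β lam s))) :=
      fun s hs => hD.measureLaplace_gCheck hβ hβ1 hlam hμ hs
    have hside : ∀ s, 0 < s → measureLaplace (dens k ∗ dens u + μ.toNNReal • (dens e ∗ dens u)) s =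
        ENNReal.ofReal ((s + lam) ^ (β - 1) * (symbol β lam s / (s * (μ + symbol β lam s))) +
          μ * (1 / (s + lam) * (symbol β lam s / (s * (μ + symbol β lam s))))) := by
      intro s hs
      have h1 := symbol_pos hβ hlam hs
      have h2 : 0 < s + lam := by linarith
      rw [measureLaplace_add, measureLaplace_smul, measureLaplace_conv, measureLaplace_conv, hLu s hs,
        measureLaplace_exp h2, measureLaplace_gammaKernel hβ' h2, neg_sub,
        ENNReal.ofReal_add (by positivity) (by positivity), ENNReal.ofReal_mul (by positivity),
        ENNReal.ofReal_mul hμ.le, ENNReal.ofReal_mul (by positivity)]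
      rfl
    refine ext_of_measureLaplace (fun s hs => ?_) fun s hs => ?_
    · rw [hside s hs]; exact ENNReal.ofReal_ne_top
    · have h1 := symbol_pos hβ hlam hs
      have h2 : 0 < s + lam := by linarith
      have h3 : ((lam ^ β).toNNReal : ℝ≥0∞) = ENNReal.ofReal (lam ^ β) := rfl
      rw [hside s hs, measureLaplace_add, measureLaplace_smul, measureLaplace_conv,
        measureLaplace_conv, hLu s hs, measureLaplace_exp h2,
        measureLaplace_levyTail hβ hβ1 hlam hs, h3, ← ENNReal.ofReal_mul (by positivity),
        ← ENNReal.ofReal_mul (by positivity), ← ENNReal.ofReal_mul (by positivity),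
        ← ENNReal.ofReal_add (by positivity) (by positivity)]
      congr 1
      have h4 : (s + lam) ^ (β - 1) = (symbol β lam s + lam ^ β) / (s + lam) := by
        rw [Real.rpow_sub_one h2.ne', symbol, sub_add_cancel]
      rw [h4]
      field_simp
      ring
  rw [ku, eu, ef, smul_dens euc, smul_dens euc, Real.coe_toNNReal _ hμ.le,
    Real.coe_toNNReal _ hlamβ,
    dens_add kuc ku0 fun r hr => mul_nonneg hμ.le (eu0 r hr),
    dens_add (euc.const_mul _) (fun r hr => mul_nonneg hlamβ (eu0 r hr)) ef0] at hmeas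
  exact eqOn_of_dens_eq (kuc.add (euc.const_mul _)) ((euc.const_mul _).add efc)
    (fun r hr => add_nonneg (ku0 r hr) (mul_nonneg hμ.le (eu0 r hr)))
    (fun r hr => add_nonneg (mul_nonneg hlamβ (eu0 r hr)) (ef0 r hr)) hmeas ht

/-- The fractional integral of `gCheck` as an ordinary integral. -/
lemma fracIntegral_gCheck (hD : IsSubordinator β lam D P) (hβ : 0 < β) (hβ1 : β < 1)
    (hlam : 0 ≤ lam) {μ : ℝ} (hμ : 0 < μ) {t : ℝ} (ht : 0 < t) :
    fracIntegral β lam (gCheck D P μ) t = Real.Gamma (1 - β) * ∫ r in (0 : ℝ)..t,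
      ((lam ^ β - μ) * (Real.exp (lam * r) * gCheck D P μ r) +
        Real.exp (lam * r) * levyTail β lam r) := by
  have h := hD.halfConv_gammaKernel_gCheck hβ hβ1 hlam hμ ht
  have hG := Real.Gamma_pos_of_pos (sub_pos.2 hβ1)
  have huc := hD.continuous_gCheck hβ hβ1 hlam hμ
  rw [halfConv_gammaKernel β lam _ ht, halfConv_exp, halfConv_exp] at h
  rw [intervalIntegral.integral_add, intervalIntegral.integral_const_mul]
  · have hE := Real.exp_pos (-lam * t)
    refine mul_left_cancel₀ (div_pos hE hG).ne' ?_
    field_simp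
    field_simp at h
    linear_combination h
  · exact (by fun_prop : Continuous fun r =>
      (lam ^ β - μ) * (Real.exp (lam * r) * gCheck D P μ r)).intervalIntegrable _ _
  · exact intervalIntegrable_levyTail hβ hβ1 hlam ht

/-- The fundamental theorem of calculus applied to the explicit integral: the integrand is
continuous on (0, ∞), and its singularity at 0, which comes from the tail, is integrable. -/
lemma hasDerivAt_fracIntegral_gCheck (hD : IsSubordinator β lam D P) (hβ : 0 < β) (hβ1 : β < 1)
    (hlam : 0 ≤ lam) {μ : ℝ} (hμ : 0 < μ) {t : ℝ} (ht : 0 < t) :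
    HasDerivAt (fracIntegral β lam (gCheck D P μ)) (Real.Gamma (1 - β) *
      ((lam ^ β - μ) * (Real.exp (lam * t) * gCheck D P μ t) +
        Real.exp (lam * t) * levyTail β lam t)) t := by
  have huc := hD.continuous_gCheck hβ hβ1 hlam hμ
  have hφ := continuousOn_levyTail hβ hlam (lam := lam)
  have hcont : ContinuousOn (fun r => (lam ^ β - μ) * (Real.exp (lam * r) * gCheck D P μ r) +
      Real.exp (lam * r) * levyTail β lam r) (Ioi 0) :=
    ContinuousOn.add (by fun_prop) (ContinuousOn.mul (by fun_prop) hφ)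
  have hint : IntervalIntegrable (fun r => (lam ^ β - μ) * (Real.exp (lam * r) * gCheck D P μ r) +
      Real.exp (lam * r) * levyTail β lam r) volume 0 t :=
    ((by fun_prop : Continuous fun r =>
      (lam ^ β - μ) * (Real.exp (lam * r) * gCheck D P μ r)).intervalIntegrable _ _).add
      (intervalIntegrable_levyTail hβ hβ1 hlam ht)
  refine ((intervalIntegral.integral_hasDerivAt_right hint
    (hcont.stronglyMeasurableAtFilter isOpen_Ioi t ht)
    (hcont.continuousAt (Ioi_mem_nhds ht))).const_mul (Real.Gamma (1 - β))).congr_of_eventuallyEq ?_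
  filter_upwards [Ioi_mem_nhds ht] with x hx
  exact hD.fracIntegral_gCheck hβ hβ1 hlam hμ hx

/-- The eigenvalue equation holds at every positive time. -/
theorem caputoDeriv_gCheck (hD : IsSubordinator β lam D P) (hβ : 0 < β) (hβ1 : β < 1)
    (hlam : 0 ≤ lam) {μ : ℝ} (hμ : 0 < μ) {t : ℝ} (ht : 0 < t) :
    caputoDeriv β lam (gCheck D P μ) t = -μ * gCheck D P μ t := by
  have hG := Real.Gamma_pos_of_pos (sub_pos.2 hβ1)
  have hE : Real.exp (-lam * t) * Real.exp (lam * t) = 1 := by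
    rw [← Real.exp_add]; simp
  rw [caputoDeriv, rlDeriv, (hD.hasDerivAt_fracIntegral_gCheck hβ hβ1 hlam hμ ht).deriv,
    hD.gCheck_zero hβ hβ1 hlam hμ]
  -- Since u(0) = 1, the Caputo correction is definitionally the Lévy tail, and it cancels the tail
  -- produced by the derivative.
  change _ - levyTail β lam t = _
  have hG1 : 1 / Real.Gamma (1 - β) * Real.Gamma (1 - β) = 1 := by field_simp
  linear_combination ((lam ^ β - μ) * gCheck D P μ t + levyTail β lam t) *
    (hE * (1 / Real.Gamma (1 - β) * Real.Gamma (1 - β)) + hG1)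

lemma laplaceConverges_gCheck (hD : IsSubordinator β lam D P) (hβ : 0 < β) (hβ1 : β < 1)
    (hlam : 0 ≤ lam) {μ : ℝ} (hμ : 0 < μ) {s : ℝ} (hs : 0 < s) :
    LaplaceConverges (gCheck D P μ) s := by
  have huc := hD.continuous_gCheck hβ hβ1 hlam hμ
  refine Integrable.mono' (integrableOn_exp_mul_Ioi (neg_lt_zero.2 hs) 0)
    (by fun_prop : Continuous _).aestronglyMeasurable (ae_of_all _ fun t => ?_)
  rw [Real.norm_of_nonneg (mul_nonneg (Real.exp_pos _).le (gCheck_nonneg D P μ t))]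
  exact mul_le_of_le_one_right (Real.exp_pos _).le (hD.gCheck_le_one hβ hlam hμ t)

lemma laplace_gCheck (hD : IsSubordinator β lam D P) (hβ : 0 < β) (hβ1 : β < 1)
    (hlam : 0 ≤ lam) {μ : ℝ} (hμ : 0 < μ) {s : ℝ} (hs : 0 < s) :
    TemperedStable.laplace (gCheck D P μ) s = symbol β lam s / (s * (μ + symbol β lam s)) := by
  have hψ := symbol_pos hβ hlam hs
  rw [TemperedStable.laplace, integral_eq_lintegral_of_nonneg_ae (ae_of_all _ fun t =>
      mul_nonneg (Real.exp_pos _).le (gCheck_nonneg D P μ t))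
    (hD.laplaceConverges_gCheck hβ hβ1 hlam hμ hs).1, ← measureLaplace_dens
      (hD.continuous_gCheck hβ hβ1 hlam hμ).continuousOn,
    hD.measureLaplace_gCheck hβ hβ1 hlam hμ hs, ENNReal.toReal_ofReal (by positivity)]

theorem isMildSolution_gCheck (hD : IsSubordinator β lam D P) (hβ : 0 < β) (hβ1 : β < 1)
    (hlam : 0 ≤ lam) {μ : ℝ} (hμ : 0 < μ) : IsMildSolution β lam μ (gCheck D P μ) where
  differentiable t ht := (hD.hasDerivAt_fracIntegral_gCheck hβ hβ1 hlam hμ ht).differentiableAt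
  converges s hs := hD.laplaceConverges_gCheck hβ hβ1 hlam hμ hs
  converges_caputo s hs := by
    refine IntegrableOn.congr_fun
      (Integrable.const_mul (hD.laplaceConverges_gCheck hβ hβ1 hlam hμ hs) (-μ))
      (fun t ht => ?_) measurableSet_Ioi
    rw [hD.caputoDeriv_gCheck hβ hβ1 hlam hμ ht]
    ring
  transform_eq s _ := setIntegral_congr_fun measurableSet_Ioi fun t ht => by
    simp only
    rw [hD.caputoDeriv_gCheck hβ hβ1 hlam hμ ht]
  symbol_eq s hs := by
    have hψ := symbol_pos hβ hlam hs
    rw [hD.laplace_gCheck hβ hβ1 hlam hμ hs, hD.gCheck_zero hβ hβ1 hlam hμ]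
    field_simp
    ring

end IsSubordinator

end TemperedStable

theorem lemma3p3 {Ω : Type*} [MeasurableSpace Ω] (P : Measure Ω) [IsProbabilityMeasure P]
    (β lam : ℝ) (hβ0 : 0 < β) (hβ1 : β < 1) (hlam : 0 ≤ lam)
    (D : ℝ≥0 → Ω → ℝ) (hD : TemperedStable.IsSubordinator β lam D P)
    (μ : ℝ) (hμ : 0 < μ) :
    (∀ t : ℝ, 0 < t →
      (∀ x : ℝ, 0 < x → IntervalIntegrable
        (fun y => TemperedStable.levyTail β lam (t - y) * TemperedStable.density D P y x)
        volume 0 t) ∧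
      IntegrableOn
        (fun x => Real.exp (-μ * x) * TemperedStable.inverseDensity β lam D P t x) (Ioi 0) ∧
      ∫ x in Ioi (0 : ℝ), Real.exp (-μ * x) * TemperedStable.inverseDensity β lam D P t x =
        TemperedStable.gCheck D P μ t) ∧
    TemperedStable.IsMildSolution β lam μ (TemperedStable.gCheck D P μ) ∧
    TemperedStable.gCheck D P μ 0 = 1 ∧
    Tendsto (TemperedStable.gCheck D P μ) (𝓝[>] 0) (𝓝 1) := by
  refine ⟨fun t ht => ⟨fun x hx => ?_, ?_, ?_⟩, ?_, ?_, ?_⟩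
  · rw [intervalIntegrable_iff_integrableOn_Ioo_of_le ht.le]
    exact hD.integrableOn_levyTail_mul_density hβ0 hβ1 hlam ht hx
  · exact hD.integrableOn_exp_mul_inverseDensity hβ0 hβ1 hlam hμ ht
  · exact hD.integral_exp_mul_inverseDensity hβ0 hβ1 hlam hμ ht
  · exact hD.isMildSolution_gCheck hβ0 hβ1 hlam hμ
  · exact hD.gCheck_zero hβ0 hβ1 hlam hμ
  · rw [← hD.gCheck_zero hβ0 hβ1 hlam hμ]
    exact (hD.continuous_gCheck hβ0 hβ1 hlam hμ).continuousAt.tendsto.mono_left nhdsWithin_le_nhds
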